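/- Let $G=\mathrm{PSL}_2(\mathbb R)$ act on the upper half-plane $\mathbb H$ and on its unit tangent bundle $T^1\mathbb H=\mathbb H\times\mathbb R/2\pi\mathbb Z$ by $$\begin{pmatrix}a&b\\c&d\end{pmatrix}(z,\theta)=\Big(\frac{az+b}{cz+d},\ \theta-2\arg(cz+d)\Big).$$ Let $\Gamma\subset G$ be a cofinite Fuchsian group, let $\kappa_1=\infty,\kappa_2,\dots,\kappa_q$ ($q\ge1$) be pairwise $\Gamma$-inequivalent cusps of $\Gamma$ with stabilizers $\Gamma_1,\dots,\Gamma_q\subset\Gamma$, and let $\Gamma_\infty=\{\begin{pmatrix}1&b\\0&1\end{pmatrix}:b\in\mathbb Z\}$. Let $\sigma_1,\dots,\sigma_q\in G$ be scaling matrices, i.e. $\sigma_j\infty=\kappa_j$ and $\sigma_j^{-1}\Gamma_j\sigma_j=\Gamma_\infty$, with $\sigma_1$ the identity (so $\Gamma_1=\Gamma_\infty$). Let $h:\mathbb R/\mathbb Z\times\mathbb R/2\pi\mathbb Z\to\mathbb C$ be a $C^\infty$-function and write $e(w)=e^{2\pi iw}$. Let $\rho(x)=\ell^{-1}e^{-1/(1-x^2)}$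 for $|x|<1$ and $\rho(x)=0$ for $|x|\ge 1$, where $\ell=\int_{-1}^1e^{-1/(1-x^2)}\,dx$, and let $\rho_\varepsilon(x)=\varepsilon^{-1}\rho(x/\varepsilon)$. For $T>0$ and $\eta\in\mathbb R$ put $\mathbb 1_{[T,\infty),0}=\mathbb 1_{[T,\infty)}$ and, for $\eta\ne0$, $\mathbb 1_{[T,\infty),\eta}(y)=\big(\mathbb 1_{[-T+\eta/2,\infty)}*\rho_{|\eta|/2}\big)(y-2T)$. Set $$f_{T,\eta}(x+iy,\theta)=\mathbb 1_{[T,\infty),\eta}(y)\,h(x,\theta),\qquad \phi^{(\kappa_j)}_{T,\eta}(z,\theta)=\sum_{\gamma\in\Gamma_j\backslash\Gamma}f_{T,\eta}\big(\sigma_j^{-1}\gamma(z,\theta)\big).$$ Then for every $j\in\{1,\dots,q\}$ there is a constant $C$, depending only on $\Gamma$, the cusps and their scaling matrices, $h$ and $j$, with the following property. For all real $1<B_0<B_1$ and every $m\in\mathbb Z$ there is $T_0$ such that for all $T\ge\max(T_0,B_1)$, all real $\eta$ with $|\eta|\le\min\big(\frac{B_1-B_0}2,\frac14\big)$ and all $y>0$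 with $y<T-\min\big(\frac{B_1-B_0}2,\frac14\big)$, $$\Bigg|\int_0^1\phi^{(\kappa_j)}_{T,\eta}(x+iy,0)\,e(mx)\,dx-y\sum_{\substack{\Gamma_\infty\left(\begin{smallmatrix}a&b\\c&d\end{smallmatrix}\right)\Gamma_\infty\in\Gamma_\infty\backslash\sigma_j^{-1}\Gamma/\Gamma_\infty\\ c>0}}\int_{-\sqrt B}^{\sqrt B}\Big(\int_0^1h(t,-2\arg(x+i))\,dt\Big)e\Big(mxy-m\frac dc\Big)dx\Bigg|\le\frac{C}{T^{3/2}},$$ where $B=\max\{1/(Tyc^2)-1,\,0\}$. -/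

import Mathlib

open scoped MatrixGroups UpperHalfPlane ContDiff

noncomputable section

namespace Horocycle

/-- The group `G = PSL(2, ℝ)`. -/
abbrev G : Type := Matrix.ProjectiveSpecialLinearGroup (Fin 2) ℝ

/-- The preimage in `SL(2, ℝ)` of a subgroup of `PSL(2, ℝ)`: all matrices `± γ` representing its
elements. -/
def lift (Γ : Subgroup G) : Subgroup SL(2, ℝ) :=
  Γ.comap (QuotientGroup.mk' (Subgroup.center SL(2, ℝ)))

/-- A cofinite Fuchsian group: a discrete subgroup of `PSL(2, ℝ)` such that some set of finite
hyperbolic area (for `dx dy / y ^ 2`) meets every orbit on the upper half-plane. -/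
def IsCofiniteFuchsian (Γ : Subgroup G) : Prop :=
  DiscreteTopology (lift Γ) ∧
    ∃ F : Set ℍ, MeasurableSet F ∧ MeasureTheory.volume F < ⊤ ∧
      ∀ z : ℍ, ∃ γ ∈ lift Γ, γ • z ∈ F

/-- The Möbius action of a real matrix of determinant one on `ℝ ∪ {∞}`. -/
def boundaryAct (g : SL(2, ℝ)) (κ : OnePoint ℝ) : OnePoint ℝ :=
  Matrix.SpecialLinearGroup.toGL g • κ

/-- `κ` is a cusp of `Γ`: it is fixed by a parabolic element of `Γ`. -/
def IsCuspOf (Γ : Subgroup G) (κ : OnePoint ℝ) : Prop :=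
  IsCusp κ ((lift Γ).map Matrix.SpecialLinearGroup.toGL)

/-- The preimage in `SL(2, ℝ)` of the stabilizer of `κ` in `Γ`. -/
def cuspStabilizer (Γ : Subgroup G) (κ : OnePoint ℝ) : Subgroup SL(2, ℝ) :=
  lift Γ ⊓ (MulAction.stabilizer (GL (Fin 2) ℝ) κ).comap Matrix.SpecialLinearGroup.toGL

/-- The matrix `(1, b; 0, 1)`. -/
def unip (b : ℝ) : SL(2, ℝ) := ⟨!![1, b; 0, 1], by simp⟩

theorem unip_mul (a b : ℝ) : unip a * unip b = unip (a + b) := by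
  ext i j
  change ((unip a).1 * (unip b).1) i j = _
  rw [Matrix.mul_apply, Fin.sum_univ_two]
  fin_cases i <;> fin_cases j <;> simp [unip, add_comm]

/-- The group of integral translations `(1, b; 0, 1)`, `b ∈ ℤ`, inside `SL(2, ℝ)`. It maps
isomorphically onto its image `Γ_∞` in `PSL(2, ℝ)`. -/
def GammaInf : Subgroup SL(2, ℝ) where
  carrier := {g | ∃ b : ℤ, g = unip b}
  one_mem' := ⟨0, by
    ext i j
    fin_cases i <;> fin_cases j <;> simp [unip]⟩
  mul_mem' := by
    rintro _ _ ⟨a, rfl⟩ ⟨b, rfl⟩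
    exact ⟨a + b, by rw [unip_mul, Int.cast_add]⟩
  inv_mem' := by
    rintro _ ⟨a, rfl⟩
    refine ⟨-a, ?_⟩
    rw [inv_eq_iff_mul_eq_one, unip_mul]
    ext i j
    fin_cases i <;> fin_cases j <;> simp [unip]

/-- `σ` represents a scaling matrix of the cusp `κ` of `Γ`: `σ ∞ = κ` and, in `PSL(2, ℝ)`,
`σ⁻¹ Γ_κ σ = Γ_∞`. -/
def IsScalingMatrix (Γ : Subgroup G) (κ : OnePoint ℝ) (σ : SL(2, ℝ)) : Prop :=
  boundaryAct σ OnePoint.infty = κ ∧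
    ∀ g : SL(2, ℝ), σ * g * σ⁻¹ ∈ cuspStabilizer Γ κ ↔ g ∈ GammaInf ∨ -g ∈ GammaInf

/-- The unit tangent bundle of the upper half-plane, with angles in `ℝ / 2πℤ`. -/
abbrev UnitTangent : Type := ℍ × Real.Angle

/-- The action `γ (z, θ) = ((az + b) / (cz + d), θ - 2 arg (cz + d))`. -/
def tangentAct (g : SL(2, ℝ)) (p : UnitTangent) : UnitTangent :=
  (g • p.1, p.2 - ((2 * Complex.arg ((g 1 0 : ℂ) * (p.1 : ℂ) + (g 1 1 : ℂ)) : ℝ) : Real.Angle))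

/-- `e(w) = exp (2 π i w)`. -/
def e (w : ℂ) : ℂ := Complex.exp (2 * Real.pi * Complex.I * w)

/-- Smoothness of a function on the torus `ℝ / ℤ × ℝ / 2πℤ`. -/
def SmoothTorus (h : UnitAddCircle × Real.Angle → ℂ) : Prop :=
  ContDiff ℝ ∞ fun p : ℝ × ℝ => h ((p.1 : UnitAddCircle), (p.2 : Real.Angle))

/-- The standard mollifier. -/
def rho (x : ℝ) : ℝ :=
  if |x| < 1 then
    (∫ t in (-1 : ℝ)..1, Real.exp (-(1 / (1 - t ^ 2))))⁻¹ * Real.exp (-(1 / (1 - x ^ 2)))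
  else 0

/-- `ρ_ε(x) = ε⁻¹ ρ(x / ε)`. -/
def rhoScaled (ε x : ℝ) : ℝ := 1 / ε * rho (x / ε)

/-- The indicator function of `[T, ∞)` for `η = 0`, and otherwise its smooth approximation
`(1_{[-T + η/2, ∞)} * ρ_{|η|/2})(y - 2T)`. -/
def cutoff (T η y : ℝ) : ℝ :=
  if η = 0 then (Set.Ici T).indicator (fun _ => 1) y
  else ∫ u : ℝ, (Set.Ici (-T + η / 2)).indicator (fun _ => 1) u *
    rhoScaled (|η| / 2) (y - 2 * T - u)

/-- `f_{T,η}(z, θ) = 1_{[T,∞),η}(y) h(x, θ)` for `z = x + iy`. -/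
def fCusp (h : UnitAddCircle × Real.Angle → ℂ) (T η : ℝ) (p : UnitTangent) : ℂ :=
  (cutoff T η p.1.im : ℂ) * h ((p.1.re : UnitAddCircle), p.2)

/-- The automorphic function
`φ_{T,η}(z, θ) = ∑_{γ ∈ Γ_κ \ Γ} f_{T,η}(σ⁻¹ γ (z, θ))`, summed over right cosets of `Γ_κ` (both
groups being replaced by their preimages in `SL(2, ℝ)`, which have the same coset space). For a
scaling matrix `σ` of `κ` the summand does not depend on the representative of the coset. -/
def phi (Γ : Subgroup G) (κ : OnePoint ℝ) (σ : SL(2, ℝ))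
    (h : UnitAddCircle × Real.Angle → ℂ) (T η : ℝ) (p : UnitTangent) : ℂ :=
  ∑' γ : Quotient (QuotientGroup.rightRel ((cuspStabilizer Γ κ).subgroupOf (lift Γ))),
    fCusp h T η (tangentAct (σ⁻¹ * (γ.out : SL(2, ℝ))) p)

/-- The matrices `(a, b; c, d)` with `c > 0` that represent elements of `σ⁻¹ Γ`. An element of
`PSL(2, ℝ)` with `c ≠ 0` has exactly one representing matrix with `c > 0`. -/
def PosElements (Γ : Subgroup G) (σ : SL(2, ℝ)) : Type :=
  {g : SL(2, ℝ) // σ * g ∈ lift Γ ∧ 0 < g 1 0}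

/-- The relation `Γ_∞ g Γ_∞ = Γ_∞ g' Γ_∞`. -/
def posSetoid (Γ : Subgroup G) (σ : SL(2, ℝ)) : Setoid (PosElements Γ σ) :=
  (DoubleCoset.setoid (GammaInf : Set SL(2, ℝ)) (GammaInf : Set SL(2, ℝ))).comap Subtype.val

/-- The double cosets in `Γ_∞ \ σ⁻¹ Γ / Γ_∞` with `c > 0`. -/
def PosDoubleCosets (Γ : Subgroup G) (σ : SL(2, ℝ)) : Type := Quotient (posSetoid Γ σ)

/-- The integral
`∫_{-√B}^{√B} (∫₀¹ h(t, -2 arg (x + i)) dt) e(mxy - md/c) dx`, `B = max {1 / (T y c²) - 1, 0}`. -/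
def mainIntegral (h : UnitAddCircle × Real.Angle → ℂ) (m : ℤ) (T y c d : ℝ) : ℂ :=
  ∫ x in (-√(max (1 / (T * y * c ^ 2) - 1) 0))..√(max (1 / (T * y * c ^ 2) - 1) 0),
    (∫ t in (0 : ℝ)..1,
      h ((t : UnitAddCircle), ((-2 * Complex.arg ((x : ℂ) + Complex.I) : ℝ) : Real.Angle))) *
      e ((m : ℂ) * x * y - m * (d / c))

theorem e_sub_int (w : ℂ) (k : ℤ) : e (w - k) = e w := by
  unfold e
  rw [Complex.exp_eq_exp_iff_exists_int]
  exact ⟨-k, by push_cast; ring⟩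

/-- The integral only depends on `c` and on `d` modulo `c`. -/
theorem mainIntegral_add_mul (h : UnitAddCircle × Real.Angle → ℂ) (m : ℤ) (T y c d : ℝ)
    (hc : 0 < c) (k : ℤ) : mainIntegral h m T y c (c * k + d) = mainIntegral h m T y c d := by
  unfold mainIntegral
  congr 1
  ext x
  congr 1
  have hc' : (c : ℂ) ≠ 0 := by exact_mod_cast hc.ne'
  rw [← e_sub_int ((m : ℂ) * x * y - m * (d / c)) (m * k)]
  congr 1
  push_cast
  field_simp
  ring

/-- The main integral attached to a double coset `Γ_∞ (a, b; c, d) Γ_∞` with `c > 0`. -/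
def mainTerm (Γ : Subgroup G) (σ : SL(2, ℝ)) (h : UnitAddCircle × Real.Angle → ℂ) (m : ℤ)
    (T y : ℝ) (D : PosDoubleCosets Γ σ) : ℂ :=
  Quotient.lift (s := posSetoid Γ σ)
    (fun g : PosElements Γ σ => mainIntegral h m T y (g.1 1 0) (g.1 1 1))
    (by
      intro g g' hg
      obtain ⟨a, ⟨k, rfl⟩, b, ⟨l, rfl⟩, hab⟩ := DoubleCoset.rel_iff.mp hg
      have h10 : g'.1 1 0 = g.1 1 0 := by
        rw [hab]
        change ((unip k).1 * g.1.1 * (unip l).1) 1 0 = _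
        simp [unip, Matrix.mul_apply, Matrix.vecMul, dotProduct, Fin.sum_univ_two]
      have h11 : g'.1 1 1 = g.1 1 0 * l + g.1 1 1 := by
        rw [hab]
        change ((unip k).1 * g.1.1 * (unip l).1) 1 1 = _
        simp [unip, Matrix.mul_apply, Matrix.vecMul, dotProduct, Fin.sum_univ_two]
      simp only [h10, h11]
      exact (mainIntegral_add_mul h m T y _ _ g.2.2 l).symm) D

end Horocycle

end

noncomputable section

namespace Horocycle

open MeasureTheory Filter Topology

/-! Unfolding the sum over `k ∈ ℤ` against the integral over `[0, 1]` turns the horocycle average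
into a finite sum, over double cosets with `c > 0`, of integrals over `ℝ`
(`IsScalingMatrix.integral_phi_eq`). Classes with `c = 0` drop out: they preserve the height `y`,
which lies below the cutoff. The substitution `x ↦ yx - d/c` makes each integral `y` times the
integral of a cutoff at height `1/(yc²(x²+1))`, times `h(a/c - x/((x²+1)yc²), -2 arg(x+i))`, times
`e(mxy - md/c)`.

Two replacements then give the main term. The smoothed cutoff becomes the indicator of `|x| ≤ √B`;
they differ on a set of measure at most a constant times `1/(√y c T)`
(`norm_integral_cutoff_sub_le`). Next `h` becomes its mean in the first variable. That variable
turns with frequency `1/ε²`, where `ε² = yc²`, along the phase `x/(x²+1)`, whose critical points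
`±1` are nondegenerate. Integrating a mean-free primitive by parts against a regularised inverse of
the phase derivative gives an error `O(1/√T)`, uniformly in the growing range of `x`
(`norm_oscillatory_integral_le`, `oscillatory_bound_le`).

It remains to add the errors over `c ≤ X`, with `X` comparable to `(Ty)^(-1/2)`. Discreteness bounds
nonzero lower-left entries of `σ⁻¹Γσ` away from zero (`IsScalingMatrix.exists_lower_left_bound`), so
the fractions `d/c` are well spaced mod 1. Hence `∑ 1/c` is `O(X)` and the number of classes is
`O(X²)`. The total is `O(y T^(-1/2) X² + y^(1/2) T^(-1) X) = O(T^(-3/2))`. The frequency `m` enters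
only through the requirement `|m| ≤ T c²`, which determines `T₀`. -/

/-! ### Mean-free primitives in one variable of doubly periodic functions. -/

theorem bounded_of_doubly_periodic {E : Type*} [NormedAddCommGroup E] {F : ℝ → ℝ → E}
    (hF : Continuous (Function.uncurry F)) {p q : ℝ} (hp : 0 < p) (hq : 0 < q)
    (h1 : ∀ t s, F (t + p) s = F t s) (h2 : ∀ t s, F t (s + q) = F t s) :
    ∃ M : ℝ, ∀ t s, ‖F t s‖ ≤ M := by
  obtain ⟨M, hM⟩ := ((isCompact_Icc (a := (0 : ℝ)) (b := p)).prod
    (isCompact_Icc (a := (0 : ℝ)) (b := q))).exists_bound_of_continuousOn hF.continuousOn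
  refine ⟨M, fun t s => ?_⟩
  have P1 : Function.Periodic (fun t => F t s) p := fun t => h1 t s
  obtain ⟨t', ht', e1⟩ := P1.exists_mem_Ico₀ hp t
  have P2 : Function.Periodic (fun s => F t' s) q := fun s => h2 t' s
  obtain ⟨s', hs', e2⟩ := P2.exists_mem_Ico₀ hq s
  have := hM (t', s') ⟨Set.Ico_subset_Icc_self ht', Set.Ico_subset_Icc_self hs'⟩
  exact (congrArg norm (e1.trans e2)).trans_le this

/-- A primitive in the first variable of `f` minus its mean. -/
def meanFreePrimitive (f : ℝ → ℝ → ℂ) (t s : ℝ) : ℂ :=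
  (∫ u in (0 : ℝ)..t, f u s) - t * ∫ u in (0 : ℝ)..1, f u s

theorem continuous_meanFreePrimitive {f : ℝ → ℝ → ℂ} (hf : Continuous (Function.uncurry f)) :
    Continuous (Function.uncurry (meanFreePrimitive f)) := by
  have hf' : Continuous (Function.uncurry fun (p : ℝ × ℝ) u => f u p.2) :=
    hf.comp (continuous_snd.prodMk (continuous_snd.comp continuous_fst))
  unfold meanFreePrimitive
  simp only [Function.uncurry_def]
  exact (intervalIntegral.continuous_parametric_intervalIntegral_of_continuous hf'
      continuous_fst).sub ((Complex.continuous_ofReal.comp continuous_fst).mul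
      (intervalIntegral.continuous_parametric_intervalIntegral_of_continuous' hf' 0 1))

/-- Subtracting the mean is what keeps the primitive periodic, hence bounded however far the fast
variable travels. -/
theorem meanFreePrimitive_add_one {f : ℝ → ℝ → ℂ} (hf : Continuous (Function.uncurry f))
    (h1 : ∀ t s, f (t + 1) s = f t s) (t s : ℝ) :
    meanFreePrimitive f (t + 1) s = meanFreePrimitive f t s := by
  have hc : Continuous fun u => f u s := hf.comp (continuous_id.prodMk continuous_const)
  have P : Function.Periodic (fun u => f u s) 1 := fun u => h1 u s
  unfold meanFreePrimitive
  rw [← intervalIntegral.integral_add_adjacent_intervals (b := t) (hc.intervalIntegrable _ _)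
    (hc.intervalIntegrable _ _), P.intervalIntegral_add_eq t 0]
  push_cast
  rw [zero_add]
  ring

theorem hasDerivAt_meanFreePrimitive_left {f : ℝ → ℝ → ℂ}
    (hf : Continuous (Function.uncurry f)) (t s : ℝ) :
    HasDerivAt (fun t => meanFreePrimitive f t s) (f t s - ∫ u in (0 : ℝ)..1, f u s) t := by
  have hc : Continuous fun u => f u s := hf.comp (continuous_id.prodMk continuous_const)
  have h1 := intervalIntegral.integral_hasDerivAt_right (hc.intervalIntegrable 0 t)
    hc.stronglyMeasurable.stronglyMeasurableAtFilter hc.continuousAt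
  have h2 := (HasDerivAt.ofReal_comp (hasDerivAt_id t)).mul_const (∫ u in (0 : ℝ)..1, f u s)
  exact (h1.sub h2).congr_deriv (by simp)

theorem hasDerivAt_meanFreePrimitive_right {f f' : ℝ → ℝ → ℂ}
    (hf : Continuous (Function.uncurry f)) (hf' : Continuous (Function.uncurry f'))
    (hd : ∀ t s, HasDerivAt (fun s => f t s) (f' t s) s) {M : ℝ} (hM : ∀ t s, ‖f' t s‖ ≤ M)
    (t s : ℝ) :
    HasDerivAt (fun s => meanFreePrimitive f t s) (meanFreePrimitive f' t s) s := by
  have key : ∀ b : ℝ, HasDerivAt (fun s => ∫ u in (0 : ℝ)..b, f u s)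
      (∫ u in (0 : ℝ)..b, f' u s) s := by
    intro b
    have hc : ∀ s, Continuous fun u => f u s := fun s =>
      hf.comp (continuous_id.prodMk continuous_const)
    have hc' : Continuous fun u => f' u s := hf'.comp (continuous_id.prodMk continuous_const)
    exact (intervalIntegral.hasDerivAt_integral_of_dominated_loc_of_deriv_le
      (F := fun s u => f u s) (F' := fun s u => f' u s) (bound := fun _ => M) (s := Set.univ)
      Filter.univ_mem (Eventually.of_forall fun s => (hc s).aestronglyMeasurable)
      ((hc s).intervalIntegrable _ _) hc'.aestronglyMeasurable
      (Eventually.of_forall fun u _ s _ => hM u s) intervalIntegrable_const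
      (Eventually.of_forall fun u _ s _ => hd u s)).2
  exact (key t).sub ((key 1).const_mul _)

/-- Continuity of both partial derivatives gives joint differentiability, so the chain rule applies
along a curve. The first term carries the fast speed `u'` and is the one to be recovered by
integration by parts. -/
theorem hasDerivAt_meanFreePrimitive_comp {f f' : ℝ → ℝ → ℂ}
    (hf : Continuous (Function.uncurry f)) (hf' : Continuous (Function.uncurry f'))
    (hd : ∀ t s, HasDerivAt (fun s => f t s) (f' t s) s) {M : ℝ} (hM : ∀ t s, ‖f' t s‖ ≤ M)
    {u v : ℝ → ℝ} {u' v' x : ℝ} (hu : HasDerivAt u u' x) (hv : HasDerivAt v v' x) :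
    HasDerivAt (fun x => meanFreePrimitive f (u x) (v x))
      (u' * (f (u x) (v x) - ∫ t in (0 : ℝ)..1, f t (v x)) +
        v' * meanFreePrimitive f' (u x) (v x)) x := by
  have hmean : Continuous fun p : ℝ × ℝ => f p.1 p.2 - ∫ t in (0 : ℝ)..1, f t p.2 := by
    have hf2 : Continuous (Function.uncurry fun (p : ℝ × ℝ) u => f u p.2) :=
      hf.comp (continuous_snd.prodMk (continuous_snd.comp continuous_fst))
    exact hf.sub (intervalIntegral.continuous_parametric_intervalIntegral_of_continuous' hf2 0 1)
  have hS := hasStrictFDerivAt_uncurry_coprod (𝕜 := ℝ) (u := (u x, v x))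
    (f := meanFreePrimitive f)
    (f₁ := fun t s => ContinuousLinearMap.toSpanSingleton ℝ
      (f t s - ∫ u in (0 : ℝ)..1, f u s))
    (f₂ := fun t s => ContinuousLinearMap.toSpanSingleton ℝ (meanFreePrimitive f' t s))
    (Eventually.of_forall fun p =>
      (hasDerivAt_meanFreePrimitive_left hf p.1 p.2).hasFDerivAt)
    (Eventually.of_forall fun p =>
      (hasDerivAt_meanFreePrimitive_right hf hf' hd hM p.1 p.2).hasFDerivAt)
    (((ContinuousLinearMap.toSpanSingletonCLE (𝕜 := ℝ) (E := ℂ)).continuous.comp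
      hmean).continuousAt)
    (((ContinuousLinearMap.toSpanSingletonCLE (𝕜 := ℝ) (E := ℂ)).continuous.comp
      (continuous_meanFreePrimitive hf')).continuousAt)
  have := hS.hasFDerivAt.comp_hasDerivAt x (hu.prodMk hv)
  simpa [Function.HasUncurry.uncurry, Function.comp_def] using this

/-! ### The phase `x/(x²+1)` and a regularised inverse of its derivative. -/

theorem neg_two_mul_arg_add_I (x : ℝ) :
    -2 * Complex.arg ((x : ℂ) + Complex.I) = 2 * Real.arctan x - Real.pi := by
  have h1 : (x : ℂ) + Complex.I = (√(1 + x ^ 2) : ℝ) *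
      (Complex.cos ((Real.pi / 2 - Real.arctan x : ℝ) : ℂ) +
        Complex.sin ((Real.pi / 2 - Real.arctan x : ℝ) : ℂ) * Complex.I) := by
    rw [← Complex.ofReal_cos, ← Complex.ofReal_sin, Real.cos_pi_div_two_sub,
      Real.sin_pi_div_two_sub, Real.sin_arctan, Real.cos_arctan]
    have h0 : √(1 + x ^ 2) ≠ 0 := by positivity
    apply Complex.ext <;> simp <;> field_simp
  rw [h1, Complex.arg_mul_cos_add_sin_mul_I (by positivity)]
  · ring
  · have h2 := Real.neg_pi_div_two_lt_arctan x
    have h3 := Real.arctan_lt_pi_div_two x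
    constructor <;> linarith [Real.pi_pos]

/-- The quotient of the derivatives of `x / (x² + 1)` and of `arctan x`. -/
def phaseSlope (x : ℝ) : ℝ := (1 - x ^ 2) / (1 + x ^ 2)

/-- A regularisation of the inverse of the derivative of `x / (x² + 1)`. -/
def regWeight (ε x : ℝ) : ℝ :=
  (1 + x ^ 2) * (phaseSlope x / (phaseSlope x ^ 2 + ε ^ 2))

/-- The derivative of `regWeight`. -/
def regWeightDeriv (ε x : ℝ) : ℝ :=
  2 * x * (phaseSlope x / (phaseSlope x ^ 2 + ε ^ 2)) +
    4 * x / (1 + x ^ 2) * ((phaseSlope x ^ 2 - ε ^ 2) / (phaseSlope x ^ 2 + ε ^ 2) ^ 2)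

/-- The sum of the two Poisson-type kernels of width `ε` centred at `1` and `-1`. -/
def twinKernel (ε x : ℝ) : ℝ := 1 / ((x - 1) ^ 2 + ε ^ 2) + 1 / ((x + 1) ^ 2 + ε ^ 2)

theorem hasDerivAt_phaseSlope (x : ℝ) :
    HasDerivAt phaseSlope (-4 * x / (1 + x ^ 2) ^ 2) x := by
  have hP : (1 + x ^ 2) ≠ 0 := by positivity
  have h1 : HasDerivAt (fun x : ℝ => 1 - x ^ 2) (-(2 * x)) x := by
    simpa using (hasDerivAt_pow 2 x).const_sub 1
  have h2 : HasDerivAt (fun x : ℝ => 1 + x ^ 2) (2 * x) x := by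
    simpa using (hasDerivAt_pow 2 x).const_add 1
  refine (h1.div h2 hP).congr_deriv ?_
  field_simp
  ring

theorem hasDerivAt_regWeight {ε : ℝ} (hε : 0 < ε) (x : ℝ) :
    HasDerivAt (regWeight ε) (regWeightDeriv ε x) x := by
  have hP : (1 + x ^ 2) ≠ 0 := by positivity
  have hD : phaseSlope x ^ 2 + ε ^ 2 ≠ 0 := by positivity
  have h2 : HasDerivAt (fun x : ℝ => 1 + x ^ 2) (2 * x) x := by
    simpa using (hasDerivAt_pow 2 x).const_add 1
  have hq := hasDerivAt_phaseSlope x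
  have h3 := h2.mul (hq.div ((hq.pow 2).add_const (ε ^ 2)) hD)
  refine h3.congr_deriv ?_
  simp only [regWeightDeriv, Pi.pow_apply, Pi.div_apply]
  field_simp
  ring

theorem continuous_phaseSlope : Continuous phaseSlope :=
  continuous_iff_continuousAt.2 fun x => (hasDerivAt_phaseSlope x).continuousAt

theorem continuous_regWeight {ε : ℝ} (hε : 0 < ε) : Continuous (regWeight ε) :=
  continuous_iff_continuousAt.2 fun x => (hasDerivAt_regWeight hε x).continuousAt

theorem continuous_regWeightDeriv {ε : ℝ} (hε : 0 < ε) : Continuous (regWeightDeriv ε) := by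
  have := continuous_phaseSlope
  have h1 : ∀ x, phaseSlope x ^ 2 + ε ^ 2 ≠ 0 := fun x => by positivity
  have h2 : ∀ x : ℝ, 1 + x ^ 2 ≠ 0 := fun x => by positivity
  have h3 : ∀ x, (phaseSlope x ^ 2 + ε ^ 2) ^ 2 ≠ 0 := fun x => by positivity
  unfold regWeightDeriv
  fun_prop (disch := assumption)

theorem continuous_twinKernel {ε : ℝ} (hε : 0 < ε) : Continuous (twinKernel ε) := by
  have h1 : ∀ x : ℝ, (x - 1) ^ 2 + ε ^ 2 ≠ 0 := fun x => by positivity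
  have h2 : ∀ x : ℝ, (x + 1) ^ 2 + ε ^ 2 ≠ 0 := fun x => by positivity
  unfold twinKernel
  fun_prop (disch := assumption)

theorem abs_phaseSlope_le_one (x : ℝ) : |phaseSlope x| ≤ 1 := by
  have hP : 0 < 1 + x ^ 2 := by positivity
  rw [phaseSlope, abs_div, abs_of_pos hP, div_le_one hP, abs_le]
  constructor <;> nlinarith [sq_nonneg x]

/-- The slope has simple zeros exactly at `±1`. For `|x| ≤ 2` its square is at least a fifth of the
squared distance to the critical point on the same side of `0`; for `|x| ≥ 2` it is bounded below.
-/
theorem inv_phaseSlope_sq_add_le {ε : ℝ} (hε : 0 < ε) (x : ℝ) :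
    1 / (phaseSlope x ^ 2 + ε ^ 2) ≤ 5 * twinKernel ε x + 5 := by
  have hP : 0 < 1 + x ^ 2 := by positivity
  have hk1 : 0 < 1 / ((x - 1) ^ 2 + ε ^ 2) := by positivity
  have hk2 : 0 < 1 / ((x + 1) ^ 2 + ε ^ 2) := by positivity
  have hq : phaseSlope x ^ 2 = ((x - 1) ^ 2 * (x + 1) ^ 2) / (1 + x ^ 2) ^ 2 := by
    rw [phaseSlope, div_pow]; congr 1; ring
  have hD : 0 < phaseSlope x ^ 2 + ε ^ 2 := by positivity
  rcases le_total (x ^ 2) 4 with h4 | h4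
  · have aux : ∀ u v : ℝ, phaseSlope x ^ 2 = (u ^ 2 * v ^ 2) / (1 + x ^ 2) ^ 2 →
        1 + x ^ 2 ≤ v ^ 2 → 1 / (phaseSlope x ^ 2 + ε ^ 2) ≤ 5 * (1 / (u ^ 2 + ε ^ 2)) := by
      intro u v h hv
      have h1 : u ^ 2 / 5 ≤ phaseSlope x ^ 2 := by
        rw [h, div_le_div_iff₀ (by norm_num) (by positivity)]
        have : (1 + x ^ 2) ^ 2 ≤ v ^ 2 * 5 := by nlinarith
        nlinarith [sq_nonneg u]
      rw [mul_one_div, div_le_div_iff₀ hD (by positivity)]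
      nlinarith [sq_nonneg ε]
    unfold twinKernel
    rcases le_total 0 x with h0 | h0
    · have := aux (x - 1) (x + 1) hq (by nlinarith)
      linarith
    · have := aux (x + 1) (x - 1) (by rw [hq, mul_comm]) (by nlinarith)
      linarith
  · have h1 : 1 / 5 ≤ phaseSlope x ^ 2 := by
      rw [phaseSlope, div_pow, div_le_div_iff₀ (by norm_num) (by positivity)]
      nlinarith
    have : 1 / (phaseSlope x ^ 2 + ε ^ 2) ≤ 5 := by
      rw [div_le_iff₀ hD]; nlinarith [sq_nonneg ε]
    unfold twinKernel
    linarith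

theorem abs_regWeight_le {ε : ℝ} (hε : 0 < ε) (x : ℝ) :
    |regWeight ε x| ≤ 3 / ε + 3 * (1 + x ^ 2) := by
  have hP : 0 < 1 + x ^ 2 := by positivity
  have hD : 0 < phaseSlope x ^ 2 + ε ^ 2 := by positivity
  have hε3 : 0 < 3 / ε := by positivity
  rw [regWeight, abs_mul, abs_of_pos hP, abs_div, abs_of_pos hD]
  rcases le_total (x ^ 2) 4 with h4 | h4
  · have : |phaseSlope x| / (phaseSlope x ^ 2 + ε ^ 2) ≤ 1 / (2 * ε) := by
      rw [div_le_div_iff₀ hD (by positivity), ← sq_abs (phaseSlope x)]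
      nlinarith [sq_nonneg (|phaseSlope x| - ε)]
    calc (1 + x ^ 2) * (|phaseSlope x| / (phaseSlope x ^ 2 + ε ^ 2)) ≤ 6 * (1 / (2 * ε)) := by
          gcongr; linarith
      _ = 3 / ε := by field_simp; norm_num
      _ ≤ _ := by nlinarith
  · have h1 : 1 / 3 ≤ |phaseSlope x| := by
      rw [phaseSlope, abs_div, abs_of_pos hP, abs_of_nonpos (by linarith),
        div_le_div_iff₀ (by norm_num) hP]
      nlinarith
    have : |phaseSlope x| / (phaseSlope x ^ 2 + ε ^ 2) ≤ 3 := by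
      rw [div_le_iff₀ hD, ← sq_abs (phaseSlope x)]
      nlinarith [sq_nonneg ε]
    nlinarith

/-- The kernels account for the neighbourhoods of `±1`, the linear term for the quadratic growth of
`regWeight` at infinity. The factor `1 + |x|` multiplying the kernel is harmless, because the kernel
is at most `2` once `|x| ≥ 2`. -/
theorem abs_regWeightDeriv_le {ε : ℝ} (hε : 0 < ε) (x : ℝ) :
    |regWeightDeriv ε x| ≤ 30 * twinKernel ε x + 30 * (1 + |x|) := by
  have hP : 0 < 1 + x ^ 2 := by positivity
  have hD : 0 < phaseSlope x ^ 2 + ε ^ 2 := by positivity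
  have e1 : 0 < (x - 1) ^ 2 + ε ^ 2 := by positivity
  have e2 : 0 < (x + 1) ^ 2 + ε ^ 2 := by positivity
  have k1 : 0 < 1 / ((x - 1) ^ 2 + ε ^ 2) := by positivity
  have k2 : 0 < 1 / ((x + 1) ^ 2 + ε ^ 2) := by positivity
  have hk : 0 ≤ twinKernel ε x := by unfold twinKernel; positivity
  have h1 : |regWeightDeriv ε x| ≤ (2 * |x| + 2) * (1 / (phaseSlope x ^ 2 + ε ^ 2)) := by
    unfold regWeightDeriv
    refine (abs_add_le _ _).trans ?_
    rw [abs_mul, abs_mul (4 * x / _), abs_div, abs_div, abs_div, abs_of_pos hD, abs_of_pos hP,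
      abs_of_pos (pow_pos hD 2), add_mul]
    have a1 : |2 * x| = 2 * |x| := by rw [abs_mul, abs_two]
    have a2 : |4 * x| / (1 + x ^ 2) ≤ 2 := by
      rw [div_le_iff₀ hP, abs_mul, ← sq_abs x, abs_of_pos (by norm_num : (0 : ℝ) < 4)]
      nlinarith [sq_nonneg (|x| - 1)]
    have a3 : |phaseSlope x ^ 2 - ε ^ 2| / (phaseSlope x ^ 2 + ε ^ 2) ^ 2 ≤
        1 / (phaseSlope x ^ 2 + ε ^ 2) := by
      rw [div_le_div_iff₀ (pow_pos hD 2) hD]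
      have : |phaseSlope x ^ 2 - ε ^ 2| ≤ phaseSlope x ^ 2 + ε ^ 2 := by
        rw [abs_le]; constructor <;> nlinarith [sq_nonneg ε, sq_nonneg (phaseSlope x)]
      nlinarith
    rw [a1]
    gcongr
    exact abs_phaseSlope_le_one x
  have h2 : (1 + |x|) * twinKernel ε x ≤ 3 * twinKernel ε x + 2 * (1 + |x|) := by
    rcases le_total |x| 2 with h | h
    · nlinarith [abs_nonneg x]
    · have hx : ∀ a : ℝ, 1 ≤ a ^ 2 → 1 / (a ^ 2 + ε ^ 2) ≤ 1 := by
        intro a ha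
        rw [div_le_one (by positivity)]
        nlinarith [sq_nonneg ε]
      have : twinKernel ε x ≤ 2 := by
        unfold twinKernel
        have b1 := hx (x - 1)
        have b2 := hx (x + 1)
        rcases le_abs.1 h with h' | h'
        · linarith [b1 (by nlinarith), b2 (by nlinarith)]
        · linarith [b1 (by nlinarith), b2 (by nlinarith)]
      nlinarith [abs_nonneg x]
  have h3 := inv_phaseSlope_sq_add_le hε x
  calc _ ≤ (2 * |x| + 2) * (5 * twinKernel ε x + 5) :=
        h1.trans (mul_le_mul_of_nonneg_left h3 (by positivity))
    _ ≤ _ := by nlinarith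

theorem integral_twinKernel_le {ε : ℝ} (hε : 0 < ε) (L : ℝ) :
    ∫ x in (-L)..L, twinKernel ε x ≤ 8 / ε := by
  have key : ∀ a x : ℝ, HasDerivAt (fun x => Real.arctan ((x - a) / ε) / ε)
      (1 / ((x - a) ^ 2 + ε ^ 2)) x := by
    intro a x
    have h1 : HasDerivAt (fun x => (x - a) / ε) (1 / ε) x :=
      ((hasDerivAt_id x).sub_const a).div_const ε
    refine (h1.arctan.div_const ε).congr_deriv ?_
    field_simp
    ring
  have hd : ∀ x, HasDerivAt (fun x => Real.arctan ((x - 1) / ε) / ε +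
      Real.arctan ((x - (-1)) / ε) / ε) (twinKernel ε x) x := by
    intro x
    have := (key 1 x).add (key (-1) x)
    exact this.congr_deriv (by simp [twinKernel])
  rw [intervalIntegral.integral_eq_sub_of_hasDerivAt (fun x _ => hd x)
    ((continuous_twinKernel hε).intervalIntegrable _ _)]
  have b : ∀ z, Real.arctan z ≤ 2 ∧ -2 ≤ Real.arctan z := fun z =>
    ⟨by linarith [Real.arctan_lt_pi_div_two z, Real.pi_lt_four],
      by linarith [Real.neg_pi_div_two_lt_arctan z, Real.pi_lt_four]⟩
  rw [← add_div, ← add_div, ← sub_div]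
  gcongr
  linarith [(b ((L - 1) / ε)).1, (b ((L - -1) / ε)).1, (b ((-L - 1) / ε)).2,
    (b ((-L - -1) / ε)).2]

/-! ### Oscillatory integrals with two nondegenerate critical points. -/

/-- The derivative of primitive times `regWeight` times `w`, scaled by `-ε²`, reproduces the
integrand up to the factor `q²/(q²+ε²)`, where `q` is `phaseSlope`. The defect `ε²/(q²+ε²)` and the
term with `ε² regWeightDeriv` both have mass `O(ε)` near `±1`, since the kernels integrate to
`O(1/ε)`. Regularising at width `ε`, the square root of the inverse frequency, balances the two and
avoids cutting out the critical points. -/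
theorem norm_oscillatory_integral_le {f f' : ℝ → ℝ → ℂ}
    (hf : Continuous (Function.uncurry f)) (hf' : Continuous (Function.uncurry f'))
    (hd : ∀ t s, HasDerivAt (fun s => f t s) (f' t s) s) {M : ℝ} (hM : ∀ t s, ‖f t s‖ ≤ M)
    (hM' : ∀ t s, ‖f' t s‖ ≤ M) (hH : ∀ t s, ‖meanFreePrimitive f t s‖ ≤ M)
    (hH' : ∀ t s, ‖meanFreePrimitive f' t s‖ ≤ M) {w w' : ℝ → ℂ} {W : ℝ}
    (hw : ∀ x, HasDerivAt w (w' x) x) (hw'c : Continuous w') (hw1 : ∀ x, ‖w x‖ ≤ 1)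
    (hw' : ∀ x, ‖w' x‖ ≤ W) {ε L : ℝ} (hε : 0 < ε) (hL : 0 ≤ L) (α : ℝ) :
    ‖∫ x in (-L)..L, (f (α - x / (x ^ 2 + 1) / ε ^ 2) (2 * Real.arctan x - Real.pi) -
        ∫ t in (0 : ℝ)..1, f t (2 * Real.arctan x - Real.pi)) * w x‖ ≤
      M * (ε ^ 2 * (400 / ε + 100 * L + 60 * L ^ 2 + 2 * L * (W * (3 / ε + 3 * (1 + L ^ 2)))) +
        2 * ε ^ 2 * (3 / ε + 3 * (1 + L ^ 2))) := by
  have hM0 : 0 ≤ M := (norm_nonneg _).trans (hM 0 0)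
  have hW0 : 0 ≤ W := (norm_nonneg _).trans (hw' 0)
  set u : ℝ → ℝ := fun x => α - x / (x ^ 2 + 1) / ε ^ 2 with hu_def
  set v : ℝ → ℝ := fun x => 2 * Real.arctan x - Real.pi with hv_def
  have hu : ∀ x, HasDerivAt u (-(phaseSlope x / (1 + x ^ 2)) / ε ^ 2) x := by
    intro x
    have hP : (x ^ 2 + 1) ≠ 0 := by positivity
    have h1 : HasDerivAt (fun x : ℝ => x ^ 2 + 1) (2 * x) x := by
      simpa using (hasDerivAt_pow 2 x).add_const 1
    refine ((((hasDerivAt_id x).div h1 hP).div_const (ε ^ 2)).const_sub α).congr_deriv ?_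
    have hP' : (1 + x ^ 2) ≠ 0 := by positivity
    simp only [phaseSlope, id]
    field_simp
    ring
  have hv : ∀ x, HasDerivAt v (2 / (1 + x ^ 2)) x := by
    intro x
    refine (((Real.hasDerivAt_arctan x).const_mul 2).sub_const Real.pi).congr_deriv ?_
    ring
  have huc : Continuous u := continuous_iff_continuousAt.2 fun x => (hu x).continuousAt
  have hvc : Continuous v := continuous_iff_continuousAt.2 fun x => (hv x).continuousAt
  have hwc : Continuous w := continuous_iff_continuousAt.2 fun x => (hw x).continuousAt
  set F : ℝ → ℂ := fun x => f (u x) (v x) - ∫ t in (0 : ℝ)..1, f t (v x) with hF_def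
  have hFc : Continuous F := by
    have hf2 : Continuous (Function.uncurry fun (p : ℝ) t => f t (v p)) :=
      hf.comp (continuous_snd.prodMk (hvc.comp continuous_fst))
    exact (hf.comp (huc.prodMk hvc)).sub
      (intervalIntegral.continuous_parametric_intervalIntegral_of_continuous' hf2 0 1)
  have hFb : ∀ x, ‖F x‖ ≤ 2 * M := by
    intro x
    refine (norm_sub_le _ _).trans ?_
    have := intervalIntegral.norm_integral_le_of_norm_le_const (a := (0 : ℝ)) (b := 1) (C := M)
      (f := fun t => f t (v x)) fun t _ => hM _ _
    rw [sub_zero, abs_one, mul_one] at this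
    linarith [hM (u x) (v x)]
  set G : ℝ → ℂ := fun x => meanFreePrimitive f (u x) (v x) with hG_def
  set K : ℝ → ℂ := fun x => meanFreePrimitive f' (u x) (v x) with hK_def
  have hGc : Continuous G := (continuous_meanFreePrimitive hf).comp (huc.prodMk hvc)
  have hKc : Continuous K := (continuous_meanFreePrimitive hf').comp (huc.prodMk hvc)
  have hG : ∀ x, HasDerivAt G (((-(phaseSlope x / (1 + x ^ 2)) / ε ^ 2 : ℝ) : ℂ) * F x +
      ((2 / (1 + x ^ 2) : ℝ) : ℂ) * K x) x := fun x =>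
    hasDerivAt_meanFreePrimitive_comp hf hf' hd hM' (hu x) (hv x)
  set D : ℝ → ℂ := fun x => (((-(phaseSlope x / (1 + x ^ 2)) / ε ^ 2 : ℝ) : ℂ) * F x +
      ((2 / (1 + x ^ 2) : ℝ) : ℂ) * K x) * (regWeight ε x * w x) +
      G x * (regWeightDeriv ε x * w x + regWeight ε x * w' x) with hD_def
  have hD : ∀ x, HasDerivAt (fun x => G x * (regWeight ε x * w x)) (D x) x := fun x =>
    (hG x).mul ((hasDerivAt_regWeight hε x).ofReal_comp.mul (hw x))
  have hDc : Continuous D := by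
    have c1 := continuous_phaseSlope
    have c2 := continuous_regWeight hε
    have c3 := continuous_regWeightDeriv hε
    have n1 : ∀ x : ℝ, 1 + x ^ 2 ≠ 0 := fun x => by positivity
    have c4 : Continuous fun x => -(phaseSlope x / (1 + x ^ 2)) / ε ^ 2 :=
      ((c1.div (by fun_prop) n1).neg).div_const _
    have c5 : Continuous fun x : ℝ => 2 / (1 + x ^ 2) := continuous_const.div (by fun_prop) n1
    fun_prop
  -- Integration by parts: an exact derivative is added and its boundary values subtracted.
  have hsplit : ∫ x in (-L)..L, F x * w x =
      (∫ x in (-L)..L, (F x * w x + (ε : ℂ) ^ 2 * D x)) -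
        (ε : ℂ) ^ 2 * (G L * (regWeight ε L * w L) - G (-L) * (regWeight ε (-L) * w (-L))) := by
    rw [← intervalIntegral.integral_eq_sub_of_hasDerivAt (fun x _ => hD x)
      (hDc.intervalIntegrable _ _), ← intervalIntegral.integral_const_mul,
      ← intervalIntegral.integral_sub]
    · simp
    · exact ((hFc.mul hwc).add (continuous_const.mul hDc)).intervalIntegrable _ _
    · exact (continuous_const.mul hDc).intervalIntegrable _ _
  have hVb : ∀ x, |x| ≤ L → |regWeight ε x| ≤ 3 / ε + 3 * (1 + L ^ 2) := by
    intro x hx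
    have : x ^ 2 ≤ L ^ 2 := sq_le_sq' (by linarith [(abs_le.1 hx).1]) (abs_le.1 hx).2
    linarith [abs_regWeight_le hε x]
  set R := 3 / ε + 3 * (1 + L ^ 2) with hR_def
  have hR0 : 0 ≤ R := by positivity
  have hpt : ∀ x, |x| ≤ L → ‖F x * w x + (ε : ℂ) ^ 2 * D x‖ ≤
      M * ε ^ 2 * (50 * twinKernel ε x + (50 + 30 * L + W * R)) := by
    intro x hx
    have hP : 0 < 1 + x ^ 2 := by positivity
    have hE : 0 < phaseSlope x ^ 2 + ε ^ 2 := by positivity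
    have hk := inv_phaseSlope_sq_add_le hε x
    have hV := hVb x hx
    have hV' := abs_regWeightDeriv_le hε x
    -- The part of `D` proportional to `F` cancels all but `ε²/(q²+ε²)` of `F w`; every other term
    -- already carries `ε²`.
    have hid : F x * w x + (ε : ℂ) ^ 2 * D x =
        ((ε ^ 2 * (1 / (phaseSlope x ^ 2 + ε ^ 2)) : ℝ) : ℂ) * (F x * w x) +
        (((ε ^ 2 * (2 * (phaseSlope x / (phaseSlope x ^ 2 + ε ^ 2))) : ℝ) : ℂ) * (K x * w x) +
        (((ε ^ 2 * regWeightDeriv ε x : ℝ) : ℂ) * (G x * w x) +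
          ((ε ^ 2 * regWeight ε x : ℝ) : ℂ) * (G x * w' x))) := by
      have hP' : (1 + (x : ℂ) ^ 2) ≠ 0 := by exact_mod_cast hP.ne'
      have hE' : ((phaseSlope x : ℂ) ^ 2 + (ε : ℂ) ^ 2) ≠ 0 := by exact_mod_cast hE.ne'
      have hε' : (ε : ℂ) ≠ 0 := by exact_mod_cast hε.ne'
      simp only [hD_def]
      generalize regWeightDeriv ε x = V'
      simp only [regWeight]
      push_cast
      field_simp
      ring
    have bq : |phaseSlope x / (phaseSlope x ^ 2 + ε ^ 2)| ≤ 1 / (phaseSlope x ^ 2 + ε ^ 2) := by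
      rw [abs_div, abs_of_pos hE]
      gcongr
      exact abs_phaseSlope_le_one x
    have hmul : ∀ (r : ℝ) (A B : ℂ) (a b c : ℝ), |r| ≤ c → ‖A‖ ≤ a → ‖B‖ ≤ b →
        ‖((ε ^ 2 * r : ℝ) : ℂ) * (A * B)‖ ≤ ε ^ 2 * (c * (a * b)) := by
      intro r A B a b c hr hA hB
      rw [norm_mul, norm_mul, Complex.norm_real, Real.norm_eq_abs, abs_mul,
        abs_of_nonneg (sq_nonneg ε), mul_assoc]
      have := (norm_nonneg A).trans hA
      have := (abs_nonneg r).trans hr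
      gcongr
    have b1 := hmul _ (F x) (w x) _ _ _ (abs_of_pos (show 0 < 1 / (phaseSlope x ^ 2 + ε ^ 2) by
      positivity)).le (hFb x) (hw1 x)
    have b2 := hmul (2 * (phaseSlope x / (phaseSlope x ^ 2 + ε ^ 2))) (K x) (w x) _ _
      (2 * (1 / (phaseSlope x ^ 2 + ε ^ 2)))
      (by rw [abs_mul, abs_two]; gcongr) (hH' (u x) (v x)) (hw1 x)
    have b3 := hmul _ (G x) (w x) _ _ _ hV' (hH (u x) (v x)) (hw1 x)
    have b4 := hmul _ (G x) (w' x) _ _ _ hV (hH (u x) (v x)) (hw' x)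
    rw [hid]
    refine (norm_add_le_of_le b1 (norm_add_le_of_le b2 (norm_add_le_of_le b3 b4))).trans ?_
    have hMε : 0 ≤ M * ε ^ 2 := by positivity
    have e1 : 2 * (1 / (phaseSlope x ^ 2 + ε ^ 2)) + 2 * (1 / (phaseSlope x ^ 2 + ε ^ 2)) +
        (30 * twinKernel ε x + 30 * (1 + |x|)) + R * W ≤
        50 * twinKernel ε x + (50 + 30 * L + W * R) := by
      linarith [mul_comm R W]
    calc _ = M * ε ^ 2 * (2 * (1 / (phaseSlope x ^ 2 + ε ^ 2)) +
          2 * (1 / (phaseSlope x ^ 2 + ε ^ 2)) +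
          (30 * twinKernel ε x + 30 * (1 + |x|)) + R * W) := by ring
      _ ≤ _ := mul_le_mul_of_nonneg_left e1 hMε
  have hint : ‖∫ x in (-L)..L, (F x * w x + (ε : ℂ) ^ 2 * D x)‖ ≤
      M * ε ^ 2 * (50 * (8 / ε) + 2 * L * (50 + 30 * L + W * R)) := by
    have hck := continuous_twinKernel hε
    refine (intervalIntegral.norm_integral_le_of_norm_le (by linarith)
      (g := fun x => M * ε ^ 2 * (50 * twinKernel ε x + (50 + 30 * L + W * R)))
      (Eventually.of_forall fun x hx => hpt x (abs_le.2 ⟨hx.1.le, hx.2⟩))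
      (Continuous.intervalIntegrable (by fun_prop) _ _)).trans ?_
    rw [intervalIntegral.integral_const_mul, intervalIntegral.integral_add
      (Continuous.intervalIntegrable (by fun_prop) _ _) intervalIntegrable_const,
      intervalIntegral.integral_const_mul, intervalIntegral.integral_const, smul_eq_mul]
    gcongr
    · exact integral_twinKernel_le hε L
    · linarith
  have hbd : ∀ x, |x| ≤ L → ‖G x * (regWeight ε x * w x)‖ ≤ M * R := by
    intro x hx
    rw [norm_mul, norm_mul, Complex.norm_real, Real.norm_eq_abs]
    have := mul_le_mul (hVb x hx) (hw1 x) (norm_nonneg _) hR0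
    rw [mul_one] at this
    exact mul_le_mul (hH _ _) this (by positivity) hM0
  have hb1 := hbd L (abs_of_nonneg hL).le
  have hb2 := hbd (-L) (by rw [abs_neg]; exact (abs_of_nonneg hL).le)
  change ‖∫ x in (-L)..L, F x * w x‖ ≤ _
  rw [hsplit]
  refine (norm_sub_le_of_le hint (r₂ := ε ^ 2 * (M * R + M * R)) ?_).trans (le_of_eq ?_)
  · rw [norm_mul, norm_pow, Complex.norm_real, Real.norm_eq_abs, abs_of_pos hε]
    gcongr
    exact norm_sub_le_of_le hb1 hb2
  · ring

/-- This is applied with `τ = 1/√T`. The relation `ε²(1+L²) = τ²` absorbs every power of `L`, and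
the hypothesis on `W` offsets the extra factor `L` from the twist. -/
theorem oscillatory_bound_le {ε τ L W M : ℝ} (hε : 0 < ε) (hετ : ε ≤ τ) (hτ : τ ≤ 1)
    (hL : 0 ≤ L) (hLε : ε ^ 2 * (1 + L ^ 2) = τ ^ 2) (hW : W * τ ^ 2 ≤ 2 * Real.pi * ε ^ 2)
    (hW0 : 0 ≤ W) (hM : 0 ≤ M) :
    M * (ε ^ 2 * (400 / ε + 100 * L + 60 * L ^ 2 + 2 * L * (W * (3 / ε + 3 * (1 + L ^ 2)))) +
        2 * ε ^ 2 * (3 / ε + 3 * (1 + L ^ 2))) ≤ 700 * M * τ := by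
  have hτ0 : 0 < τ := hε.trans_le hετ
  have h1 : ε * L ≤ τ := by
    refine abs_le_of_sq_le_sq' ?_ hτ0.le |>.2
    nlinarith
  have h0 : 0 ≤ ε * L := by positivity
  have hW7 : W * τ ^ 2 ≤ 7 * ε ^ 2 := by nlinarith [Real.pi_lt_d2, sq_nonneg ε]
  have hWτ : W ≤ 7 := by
    by_contra hcon
    have : ε ^ 2 ≤ τ ^ 2 := pow_le_pow_left₀ hε.le hετ 2
    nlinarith [pow_pos hτ0 2]
  have e1 : ε ^ 2 * (400 / ε + 100 * L + 60 * L ^ 2 + 2 * L * (W * (3 / ε + 3 * (1 + L ^ 2)))) +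
      2 * ε ^ 2 * (3 / ε + 3 * (1 + L ^ 2)) =
      406 * ε + 100 * (ε * (ε * L)) + 60 * (ε * L) ^ 2 + 6 * (W * (ε * L)) +
        6 * L * (W * (ε ^ 2 * (1 + L ^ 2))) + 6 * (ε ^ 2 * (1 + L ^ 2)) := by
    field_simp
    ring
  rw [e1, hLε]
  have i1 : ε * (ε * L) ≤ τ := by nlinarith
  have i2 : (ε * L) ^ 2 ≤ τ := by nlinarith
  have i3 : W * (ε * L) ≤ 7 * τ := by nlinarith
  have i4 : L * (W * τ ^ 2) ≤ 7 * τ := by nlinarith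
  have i5 : τ ^ 2 ≤ τ := by nlinarith
  nlinarith

/-! ### Replacing a torus function by its mean in the first variable. -/

theorem norm_e_ofReal (x : ℝ) : ‖e x‖ = 1 := by
  have : 2 * Real.pi * Complex.I * x = ((2 * Real.pi * x : ℝ) : ℂ) * Complex.I := by
    push_cast; ring
  rw [e, this, Complex.norm_exp_ofReal_mul_I]

theorem continuous_e : Continuous e := by unfold e; fun_prop

/-- The lift to `ℝ × ℝ` of a function on the torus. -/
def torusLift (h : UnitAddCircle × Real.Angle → ℂ) (t s : ℝ) : ℂ :=
  h ((t : UnitAddCircle), (s : Real.Angle))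

theorem torusLift_add_one (h : UnitAddCircle × Real.Angle → ℂ) (t s : ℝ) :
    torusLift h (t + 1) s = torusLift h t s := by
  simp [torusLift]

theorem torusLift_add_two_pi (h : UnitAddCircle × Real.Angle → ℂ) (t s : ℝ) :
    torusLift h t (s + 2 * Real.pi) = torusLift h t s := by
  simp [torusLift]

theorem SmoothTorus.continuous_torusLift {h : UnitAddCircle × Real.Angle → ℂ}
    (hh : SmoothTorus h) : Continuous (Function.uncurry (torusLift h)) :=
  ContDiff.continuous hh

/-- Compactness of the torus makes `M` depend on `h` alone; the shift `α`, later `a/c`, plays no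
role. The condition on `m` ensures that the twist varies slowly compared with the phase. -/
theorem SmoothTorus.exists_mean_free_bound {h : UnitAddCircle × Real.Angle → ℂ}
    (hh : SmoothTorus h) :
    ∃ M : ℝ, 0 ≤ M ∧ (∀ p, ‖h p‖ ≤ M) ∧
      ∀ (m : ℤ) (T y c d α : ℝ), 1 ≤ T → 0 < y → 0 < c → |(m : ℝ)| ≤ T * c ^ 2 →
        ‖(∫ x in (-√(max (1 / (T * y * c ^ 2) - 1) 0))..√(max (1 / (T * y * c ^ 2) - 1) 0),
          torusLift h (α - x / (x ^ 2 + 1) / (y * c ^ 2))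
            (-2 * Complex.arg ((x : ℂ) + Complex.I)) * e ((m : ℂ) * x * y - m * (d / c))) -
          mainIntegral h m T y c d‖ ≤ 700 * M / √T := by
  have hF : ContDiff ℝ ∞ (Function.uncurry (torusLift h)) := hh
  have hfc := hh.continuous_torusLift
  set f := torusLift h with hf_def
  set f' : ℝ → ℝ → ℂ := fun t s => fderiv ℝ (Function.uncurry f) (t, s) (0, 1) with hf'_def
  have hd : ∀ t s, HasDerivAt (fun s => f t s) (f' t s) s := by
    intro t s
    have h1 := (hF.differentiable (by simp) (t, s)).hasFDerivAt.comp_hasDerivAt s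
      ((hasDerivAt_const s t).prodMk (hasDerivAt_id s))
    exact h1
  have hf'c : Continuous (Function.uncurry f') :=
    (hF.continuous_fderiv (by simp)).clm_apply continuous_const
  have p1 := torusLift_add_one h
  have p2 := torusLift_add_two_pi h
  have p1' : ∀ t s, f' (t + 1) s = f' t s := by
    intro t s
    refine (hd (t + 1) s).unique ?_
    simp only [hf_def, p1]
    exact hd t s
  have p2' : ∀ t s, f' t (s + 2 * Real.pi) = f' t s := by
    intro t s
    refine HasDerivAt.unique ((hd t (s + 2 * Real.pi)).comp_add_const s (2 * Real.pi)) ?_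
    simp only [hf_def, p2]
    exact hd t s
  have H2 : ∀ g : ℝ → ℝ → ℂ, (∀ t s, g t (s + 2 * Real.pi) = g t s) → ∀ t s,
      meanFreePrimitive g t (s + 2 * Real.pi) = meanFreePrimitive g t s := by
    intro g hg t s
    simp only [meanFreePrimitive, hg]
  obtain ⟨M1, hM1⟩ := bounded_of_doubly_periodic hfc one_pos Real.two_pi_pos p1 p2
  obtain ⟨M2, hM2⟩ := bounded_of_doubly_periodic hf'c one_pos Real.two_pi_pos p1' p2'
  obtain ⟨M3, hM3⟩ := bounded_of_doubly_periodic (continuous_meanFreePrimitive hfc) one_pos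
    Real.two_pi_pos (meanFreePrimitive_add_one hfc p1) (H2 f p2)
  obtain ⟨M4, hM4⟩ := bounded_of_doubly_periodic (continuous_meanFreePrimitive hf'c) one_pos
    Real.two_pi_pos (meanFreePrimitive_add_one hf'c p1') (H2 f' p2')
  set M := max (max M1 M2) (max M3 M4)
  have hM1' : M1 ≤ M := (le_max_left _ _).trans (le_max_left _ _)
  have hM2' : M2 ≤ M := (le_max_right _ _).trans (le_max_left _ _)
  have hM3' : M3 ≤ M := (le_max_left _ _).trans (le_max_right _ _)
  have hM4' : M4 ≤ M := (le_max_right _ _).trans (le_max_right _ _)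
  have hM0 : 0 ≤ M := (norm_nonneg _).trans ((hM1 0 0).trans hM1')
  refine ⟨M, hM0, ?_, ?_⟩
  · rintro ⟨a, b⟩
    obtain ⟨t, rfl⟩ := QuotientAddGroup.mk_surjective a
    obtain ⟨s, rfl⟩ := QuotientAddGroup.mk_surjective b
    exact (hM1 t s).trans hM1'
  intro m T y c d α hT hy hc hm
  have hT0 : 0 < T := by linarith
  set L := √(max (1 / (T * y * c ^ 2) - 1) 0) with hL_def
  have hyc : 0 < y * c ^ 2 := by positivity
  set w : ℝ → ℂ := fun x => e ((m : ℂ) * x * y - m * (d / c)) with hw_def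
  have hwr : ∀ x : ℝ, w x = e (((m : ℝ) * x * y - m * (d / c) : ℝ) : ℂ) := by
    intro x; simp only [hw_def]; push_cast; rfl
  have hw1 : ∀ x, ‖w x‖ = 1 := fun x => by rw [hwr, norm_e_ofReal]
  have hw : ∀ x, HasDerivAt w (w x * (2 * Real.pi * Complex.I * (m * y))) x := by
    intro x
    have h1 : HasDerivAt (fun z : ℂ => Complex.exp (2 * Real.pi * Complex.I *
        ((m : ℂ) * z * y - m * (d / c))))
        (Complex.exp (2 * Real.pi * Complex.I * ((m : ℂ) * x * y - m * (d / c))) *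
          (2 * Real.pi * Complex.I * ((m : ℂ) * 1 * y))) x :=
      HasDerivAt.cexp (((((hasDerivAt_id (x : ℂ)).const_mul _).mul_const _).sub_const _).const_mul _)
    have h2 := h1.comp_ofReal
    rw [mul_one] at h2
    exact h2
  have hwc : Continuous w := continuous_iff_continuousAt.2 fun x => (hw x).continuousAt
  set ε := √(y * c ^ 2) with hε_def
  have hε : 0 < ε := Real.sqrt_pos.2 hyc
  have hε2 : ε ^ 2 = y * c ^ 2 := Real.sq_sqrt hyc.le
  have hL0 : 0 ≤ L := Real.sqrt_nonneg _
  have hconv : (∫ x in (-L)..L, f (α - x / (x ^ 2 + 1) / (y * c ^ 2))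
        (-2 * Complex.arg ((x : ℂ) + Complex.I)) * w x) - mainIntegral h m T y c d =
      ∫ x in (-L)..L, (f (α - x / (x ^ 2 + 1) / ε ^ 2) (2 * Real.arctan x - Real.pi) -
        ∫ t in (0 : ℝ)..1, f t (2 * Real.arctan x - Real.pi)) * w x := by
    have e1 : mainIntegral h m T y c d = ∫ x in (-L)..L,
        (∫ t in (0 : ℝ)..1, f t (2 * Real.arctan x - Real.pi)) * w x := by
      simp only [mainIntegral, neg_two_mul_arg_add_I]
      rfl
    have cu : Continuous fun x : ℝ => α - x / (x ^ 2 + 1) / (y * c ^ 2) := by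
      have : ∀ x : ℝ, x ^ 2 + 1 ≠ 0 := fun x => by positivity
      exact continuous_const.sub ((continuous_id.div (by fun_prop) this).div_const _)
    have cv : Continuous fun x : ℝ => 2 * Real.arctan x - Real.pi := by fun_prop
    have hf2 : Continuous (Function.uncurry fun (x : ℝ) t =>
        f t (2 * Real.arctan x - Real.pi)) :=
      hfc.comp (continuous_snd.prodMk (cv.comp continuous_fst))
    simp only [neg_two_mul_arg_add_I, hε2]
    rw [e1, ← intervalIntegral.integral_sub]
    · simp only [sub_mul]
    · exact ((hfc.comp (cu.prodMk cv)).mul hwc).intervalIntegrable _ _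
    · exact ((intervalIntegral.continuous_parametric_intervalIntegral_of_continuous'
        hf2 0 1).mul hwc).intervalIntegrable _ _
  rw [hconv]
  -- If `B = 0` the range is empty; otherwise `1 + L² = 1/(T y c²)` supplies the relation between
  -- `ε`, `L` and `τ`.
  rcases le_or_gt (1 / (T * y * c ^ 2) - 1) 0 with hB | hB
  · have : L = 0 := by rw [hL_def, max_eq_right hB, Real.sqrt_zero]
    rw [this, neg_zero, intervalIntegral.integral_same, norm_zero]
    positivity
  have hL2 : L ^ 2 = 1 / (T * y * c ^ 2) - 1 := by
    rw [hL_def, Real.sq_sqrt (le_max_right _ _), max_eq_left hB.le]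
  set τ := 1 / √T with hτ_def
  have hτ2 : τ ^ 2 = 1 / T := by rw [hτ_def, div_pow, Real.sq_sqrt hT0.le, one_pow]
  have hτ0 : 0 < τ := by positivity
  have hkey : ε ^ 2 * (1 + L ^ 2) = τ ^ 2 := by
    rw [hε2, hL2, hτ2]
    field_simp
    ring
  refine (norm_oscillatory_integral_le hfc hf'c hd (fun t s => (hM1 t s).trans hM1')
    (fun t s => (hM2 t s).trans hM2') (fun t s => (hM3 t s).trans hM3')
    (fun t s => (hM4 t s).trans hM4') (W := 2 * Real.pi * (|(m : ℝ)| * y)) hw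
    (hwc.mul continuous_const) (fun x => (hw1 x).le) ?_ hε hL0 α).trans ?_
  · intro x
    rw [norm_mul, hw1, one_mul]
    simp [abs_of_pos Real.pi_pos, abs_of_pos hy]
  · have := oscillatory_bound_le (ε := ε) (τ := τ) (L := L) (M := M)
      (W := 2 * Real.pi * (|(m : ℝ)| * y)) hε ?_ ?_ hL0 hkey ?_ (by positivity) hM0
    · rw [hτ_def, mul_one_div] at this
      exact this
    · refine abs_le_of_sq_le_sq' ?_ hτ0.le |>.2
      nlinarith [sq_nonneg (ε * L)]
    · rw [hτ_def, div_le_one (Real.sqrt_pos.2 hT0)]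
      exact Real.one_le_sqrt.2 hT
    · rw [hτ2, hε2, mul_one_div, div_le_iff₀ hT0]
      have := mul_le_mul_of_nonneg_right hm hy.le
      nlinarith [Real.pi_pos]

/-! ### The mollifier and the smoothed cutoff. -/

theorem measurable_exp_bump : Measurable fun t : ℝ => Real.exp (-(1 / (1 - t ^ 2))) := by
  fun_prop

theorem intervalIntegrable_exp_bump :
    IntervalIntegrable (fun t : ℝ => Real.exp (-(1 / (1 - t ^ 2)))) volume (-1) 1 := by
  refine (intervalIntegrable_const (c := (1 : ℝ))).mono_fun
    measurable_exp_bump.aestronglyMeasurable ?_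
  rw [Filter.EventuallyLE, ae_restrict_iff' measurableSet_uIoc]
  refine Eventually.of_forall fun t ht => ?_
  rw [Set.uIoc_of_le (by norm_num)] at ht
  rw [Real.norm_of_nonneg (Real.exp_pos _).le, norm_one, Real.exp_le_one_iff]
  have : 0 ≤ 1 - t ^ 2 := by nlinarith [ht.1, ht.2]
  have : 0 ≤ 1 / (1 - t ^ 2) := by positivity
  linarith

theorem integral_exp_bump_pos : 0 < ∫ t in (-1 : ℝ)..1, Real.exp (-(1 / (1 - t ^ 2))) :=
  intervalIntegral.intervalIntegral_pos_of_pos intervalIntegrable_exp_bump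
    (fun _ => Real.exp_pos _) (by norm_num)

theorem rho_eq_indicator : rho = (Set.Ioo (-1 : ℝ) 1).indicator fun x =>
    (∫ t in (-1 : ℝ)..1, Real.exp (-(1 / (1 - t ^ 2))))⁻¹ * Real.exp (-(1 / (1 - x ^ 2))) := by
  ext x
  by_cases hx : |x| < 1
  · have hx' : x ∈ Set.Ioo (-1 : ℝ) 1 := abs_lt.1 hx
    rw [Set.indicator_of_mem hx', rho, if_pos hx]
  · have hx' : x ∉ Set.Ioo (-1 : ℝ) 1 := fun h => hx (abs_lt.2 h)
    rw [Set.indicator_of_notMem hx', rho, if_neg hx]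

theorem measurable_rho : Measurable rho := by
  rw [rho_eq_indicator]
  exact (measurable_exp_bump.const_mul _).indicator measurableSet_Ioo

theorem rho_nonneg (x : ℝ) : 0 ≤ rho x := by
  rw [rho_eq_indicator]
  exact Set.indicator_nonneg (fun x _ => mul_nonneg (inv_nonneg.2 integral_exp_bump_pos.le)
    (Real.exp_pos _).le) x

theorem integrable_rho : Integrable rho := by
  rw [rho_eq_indicator, integrable_indicator_iff measurableSet_Ioo]
  exact (((intervalIntegrable_iff_integrableOn_Ioo_of_le (by norm_num)).1
    intervalIntegrable_exp_bump).const_mul _)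

theorem integral_rho : ∫ x, rho x = 1 := by
  rw [rho_eq_indicator, integral_indicator measurableSet_Ioo, ← integral_Ioc_eq_integral_Ioo,
    ← intervalIntegral.integral_of_le (by norm_num), intervalIntegral.integral_const_mul,
    inv_mul_cancel₀ integral_exp_bump_pos.ne']

theorem rhoScaled_nonneg {ε : ℝ} (hε : 0 < ε) (x : ℝ) : 0 ≤ rhoScaled ε x :=
  mul_nonneg (by positivity) (rho_nonneg _)

theorem rhoScaled_eq_zero {ε x : ℝ} (hε : 0 < ε) (hx : ε ≤ |x|) : rhoScaled ε x = 0 := by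
  have : ¬ |x / ε| < 1 := by
    rw [abs_div, abs_of_pos hε, div_lt_one hε]; linarith
  rw [rhoScaled, rho, if_neg this, mul_zero]

theorem measurable_rhoScaled (ε : ℝ) : Measurable (rhoScaled ε) :=
  (measurable_rho.comp (measurable_id.div_const ε)).const_mul _

theorem integrable_rhoScaled {ε : ℝ} (hε : 0 < ε) : Integrable (rhoScaled ε) :=
  (integrable_rho.comp_div hε.ne').const_mul _

theorem integral_rhoScaled {ε : ℝ} (hε : 0 < ε) : ∫ x, rhoScaled ε x = 1 := by
  unfold rhoScaled
  rw [integral_const_mul, Measure.integral_comp_div, integral_rho, abs_of_pos hε]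
  field_simp
  simp

theorem cutoff_eq_integral {η : ℝ} (hη : η ≠ 0) (T y : ℝ) :
    cutoff T η y = ∫ v, (Set.Ici (-T + η / 2)).indicator (fun _ => (1 : ℝ)) (y - 2 * T - v) *
      rhoScaled (|η| / 2) v := by
  rw [cutoff, if_neg hη, ← integral_sub_left_eq_self _ volume (y - 2 * T)]
  simp

theorem measurable_cutoff (T η : ℝ) : Measurable (cutoff T η) := by
  by_cases hη : η = 0
  · have : cutoff T η = (Set.Ici T).indicator fun _ => 1 := by
      ext y; rw [cutoff, if_pos hη]
    rw [this]
    exact measurable_const.indicator measurableSet_Ici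
  · have : cutoff T η = fun y => ∫ u : ℝ, (Set.Ici (-T + η / 2)).indicator (fun _ => 1) u *
        rhoScaled (|η| / 2) (y - 2 * T - u) := by
      ext y; rw [cutoff, if_neg hη]
    rw [this]
    have hm : Measurable fun p : ℝ × ℝ => (Set.Ici (-T + η / 2)).indicator (fun _ => (1 : ℝ)) p.2 *
        rhoScaled (|η| / 2) (p.1 - 2 * T - p.2) :=
      ((measurable_const.indicator measurableSet_Ici).comp measurable_snd).mul
        ((measurable_rhoScaled _).comp ((measurable_fst.sub_const _).sub measurable_snd))
    exact hm.stronglyMeasurable.integral_prod_right.measurable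

theorem cutoff_nonneg (T η y : ℝ) : 0 ≤ cutoff T η y := by
  by_cases hη : η = 0
  · rw [cutoff, if_pos hη]
    exact Set.indicator_nonneg (fun _ _ => zero_le_one) _
  · rw [cutoff_eq_integral hη]
    exact integral_nonneg fun v => mul_nonneg
      (Set.indicator_nonneg (fun _ _ => zero_le_one) _) (rhoScaled_nonneg (by positivity) v)

theorem cutoff_le_one (T η y : ℝ) : cutoff T η y ≤ 1 := by
  by_cases hη : η = 0
  · rw [cutoff, if_pos hη]
    exact Set.indicator_le' (fun _ _ => le_rfl) (fun _ _ => zero_le_one) _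
  · have hε : 0 < |η| / 2 := by positivity
    rw [cutoff_eq_integral hη]
    refine le_of_le_of_eq ?_ (integral_rhoScaled hε)
    refine integral_mono_of_nonneg (Eventually.of_forall fun v => mul_nonneg
      (Set.indicator_nonneg (fun _ _ => zero_le_one) _) (rhoScaled_nonneg hε v))
      (integrable_rhoScaled hε) (Eventually.of_forall fun v => ?_)
    exact mul_le_of_le_one_left (rhoScaled_nonneg hε v)
      (Set.indicator_le' (fun _ _ => le_rfl) (fun _ _ => zero_le_one) _)

/-- The transition takes place between `T` and `T + η`, so `|η|` is a margin valid for either sign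
of `η`. -/
theorem cutoff_eq_zero {T η y : ℝ} (hy : y < T - |η|) : cutoff T η y = 0 := by
  by_cases hη : η = 0
  · rw [cutoff, if_pos hη, Set.indicator_of_notMem]
    rw [hη, abs_zero, sub_zero] at hy
    exact not_le.2 hy
  · have hε : 0 < |η| / 2 := by positivity
    rw [cutoff_eq_integral hη]
    refine (integral_congr_ae (Eventually.of_forall fun v => ?_)).trans (integral_zero ℝ ℝ)
    rcases le_or_gt (|η| / 2) |v| with hv | hv
    · simp [rhoScaled_eq_zero hε hv]
    · have : y - 2 * T - v ∉ Set.Ici (-T + η / 2) := by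
        rw [Set.mem_Ici, not_le]
        linarith [(abs_lt.1 hv).1, neg_abs_le η]
      simp only [Set.indicator_of_notMem this, zero_mul]

theorem cutoff_eq_one {T η y : ℝ} (hy : T + |η| < y) : cutoff T η y = 1 := by
  by_cases hη : η = 0
  · rw [cutoff, if_pos hη, Set.indicator_of_mem]
    rw [hη, abs_zero, add_zero] at hy
    exact hy.le
  · have hε : 0 < |η| / 2 := by positivity
    rw [cutoff_eq_integral hη]
    refine Eq.trans ?_ (integral_rhoScaled hε)
    refine integral_congr_ae (Eventually.of_forall fun v => ?_)
    rcases le_or_gt (|η| / 2) |v| with hv | hv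
    · simp [rhoScaled_eq_zero hε hv]
    · have : y - 2 * T - v ∈ Set.Ici (-T + η / 2) := by
        rw [Set.mem_Ici]
        linarith [(abs_lt.1 hv).2, le_abs_self η]
      simp only [Set.indicator_of_mem this, one_mul]

/-- Smoothed and sharp cutoffs can differ only where the height `Λ/(x²+1)` is within `|η|` of `T`,
that is, for `√a ≤ |x| ≤ √b`. -/
theorem norm_integral_cutoff_sub_le {T η Λ M : ℝ} (hT : 1 ≤ T) (hη : |η| ≤ 1 / 4) (hΛ : 0 < Λ)
    {g : ℝ → ℂ} (hg : Measurable g) (hM : ∀ x, ‖g x‖ ≤ M) :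
    Integrable (fun x : ℝ => (cutoff T η (Λ / (x ^ 2 + 1)) : ℂ) * g x) ∧
    ‖(∫ x : ℝ, (cutoff T η (Λ / (x ^ 2 + 1)) : ℂ) * g x) -
      ∫ x in (-√(max (Λ / T - 1) 0))..√(max (Λ / T - 1) 0), g x‖ ≤ M * (2 * (√Λ / T)) := by
  have hM0 : 0 ≤ M := (norm_nonneg _).trans (hM 0)
  have hη0 := abs_nonneg η
  have hT0 : 0 < T := by linarith
  have hTm : 0 < T - |η| := by linarith
  have hTp : 0 < T + |η| := by linarith
  set a := max (Λ / (T + |η|) - 1) 0 with ha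
  set b := max (Λ / (T - |η|) - 1) 0 with hb
  set B := max (Λ / T - 1) 0 with hB
  have haB : a ≤ B := max_le_max (by gcongr; linarith) le_rfl
  have hBb : B ≤ b := max_le_max (by gcongr; linarith) le_rfl
  have hsaB := Real.sqrt_le_sqrt haB
  have hsBb := Real.sqrt_le_sqrt hBb
  have ha0 : 0 ≤ a := le_max_right _ _
  have hb0 : 0 ≤ b := le_max_right _ _
  have hsa := Real.sqrt_nonneg a
  have hzero : ∀ x : ℝ, √b < |x| → cutoff T η (Λ / (x ^ 2 + 1)) = 0 := by
    intro x hx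
    apply cutoff_eq_zero
    have h1 : b < x ^ 2 := by
      rw [← sq_abs]; exact (Real.sqrt_lt' ((Real.sqrt_nonneg _).trans_lt hx)).1 hx
    have h2 : Λ / (T - |η|) < x ^ 2 + 1 := by linarith [le_max_left (Λ / (T - |η|) - 1) 0]
    rw [div_lt_iff₀ hTm] at h2
    rw [div_lt_iff₀ (by positivity)]
    linarith
  have hone : ∀ x : ℝ, |x| < √a → cutoff T η (Λ / (x ^ 2 + 1)) = 1 := by
    intro x hx
    apply cutoff_eq_one
    have h1 : x ^ 2 < a := by
      rw [← sq_abs]; exact (Real.lt_sqrt (abs_nonneg _)).1 hx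
    have h2 : x ^ 2 + 1 < Λ / (T + |η|) := by
      rcases max_choice (Λ / (T + |η|) - 1) 0 with h | h
      · rw [ha, h] at h1; linarith
      · rw [ha, h] at h1; nlinarith
    rw [lt_div_iff₀ hTp] at h2
    rw [lt_div_iff₀ (by positivity)]
    linarith
  have hmeas : Measurable fun x : ℝ => (cutoff T η (Λ / (x ^ 2 + 1)) : ℂ) * g x := by
    refine Measurable.mul (Complex.measurable_ofReal.comp ((measurable_cutoff T η).comp ?_)) hg
    fun_prop
  have hbound : ∀ x : ℝ, ‖(cutoff T η (Λ / (x ^ 2 + 1)) : ℂ)‖ ≤ 1 := fun x => by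
    rw [Complex.norm_real, Real.norm_of_nonneg (cutoff_nonneg _ _ _)]
    exact cutoff_le_one _ _ _
  have hint : Integrable fun x : ℝ => (cutoff T η (Λ / (x ^ 2 + 1)) : ℂ) * g x := by
    have hi : Integrable ((Set.Icc (-√b) √b).indicator fun _ => M) :=
      (integrable_indicator_iff measurableSet_Icc).2 (integrableOn_const (by simp))
    refine hi.mono' hmeas.aestronglyMeasurable (Eventually.of_forall fun x => ?_)
    rcases le_or_gt |x| √b with hx | hx
    · have hx' : x ∈ Set.Icc (-√b) √b := abs_le.1 hx
      rw [Set.indicator_of_mem hx', norm_mul]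
      calc _ ≤ 1 * M := mul_le_mul (hbound x) (hM x) (norm_nonneg _) zero_le_one
        _ = M := one_mul _
    · rw [hzero x hx, Complex.ofReal_zero, zero_mul, norm_zero]
      exact Set.indicator_nonneg (fun _ _ => hM0) _
  refine ⟨hint, ?_⟩
  have hint2 : Integrable ((Set.Ioc (-√B) √B).indicator g) :=
    (integrable_indicator_iff measurableSet_Ioc).2
      (Measure.integrableOn_of_bounded (M := M) (by simp) hg.aestronglyMeasurable
        (Eventually.of_forall hM))
  rw [intervalIntegral.integral_of_le (by linarith [Real.sqrt_nonneg B]),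
    ← integral_indicator measurableSet_Ioc, ← integral_sub hint hint2]
  set S : Set ℝ := Set.Icc √a √b ∪ Set.Icc (-√b) (-√a) with hS
  have hSm : MeasurableSet S := measurableSet_Icc.union measurableSet_Icc
  have hSf : volume S ≠ ⊤ :=
    (measure_union_lt_top (by simp) (by simp)).ne
  have hvol : volume.real S ≤ 2 * (√Λ / T) := by
    refine (measureReal_union_le _ _).trans ?_
    rw [Real.volume_real_Icc_of_le (by linarith), Real.volume_real_Icc_of_le (by linarith)]
    -- This form stays uniform when `a` vanishes, where dividing by `√a + √b` would lose control.
    have h1 : √b - √a ≤ √(b - a) := by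
      rw [sub_le_iff_le_add]
      have hba : 0 ≤ b - a := by linarith
      refine Real.sqrt_le_iff.2 ⟨by positivity, ?_⟩
      nlinarith [Real.sq_sqrt hba, Real.sq_sqrt ha0, Real.sqrt_nonneg (b - a)]
    have h2 : b - a ≤ Λ / T ^ 2 := by
      have h3 : b - a ≤ Λ / (T - |η|) - Λ / (T + |η|) := by
        have h4 : Λ / (T + |η|) ≤ Λ / (T - |η|) := by gcongr; linarith
        have h5 := le_max_left (Λ / (T + |η|) - 1) 0
        have h6 := le_max_right (Λ / (T + |η|) - 1) 0
        rcases max_choice (Λ / (T - |η|) - 1) 0 with h | h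
        · rw [hb, h]; linarith
        · rw [hb, h]; linarith
      refine h3.trans ?_
      rw [div_sub_div _ _ hTm.ne' hTp.ne', div_le_div_iff₀ (by positivity) (by positivity)]
      have : 2 * |η| * T ^ 2 ≤ (T - |η|) * (T + |η|) := by nlinarith
      nlinarith
    have h3 : √(b - a) ≤ √Λ / T := by
      calc √(b - a) ≤ √(Λ / T ^ 2) := Real.sqrt_le_sqrt h2
        _ = √Λ / T := by rw [Real.sqrt_div hΛ.le, Real.sqrt_sq hT0.le]
    linarith
  have hfin : Integrable (S.indicator fun _ => M) :=
    (integrable_indicator_iff hSm).2 (integrableOn_const hSf)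
  calc _ ≤ ∫ x, S.indicator (fun _ => M) x := by
        refine norm_integral_le_of_norm_le hfin (Eventually.of_forall fun x => ?_)
        by_cases hxS : x ∈ S
        · rw [Set.indicator_of_mem hxS]
          by_cases hxB : x ∈ Set.Ioc (-√B) √B
          · rw [Set.indicator_of_mem hxB, ← sub_one_mul, norm_mul]
            have : ‖(cutoff T η (Λ / (x ^ 2 + 1)) : ℂ) - 1‖ ≤ 1 := by
              rw [← Complex.ofReal_one, ← Complex.ofReal_sub, Complex.norm_real,
                Real.norm_eq_abs, abs_le]
              constructor <;> linarith [cutoff_nonneg T η (Λ / (x ^ 2 + 1)),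
                cutoff_le_one T η (Λ / (x ^ 2 + 1))]
            calc _ ≤ 1 * M := mul_le_mul this (hM x) (norm_nonneg _) zero_le_one
              _ = M := one_mul _
          · rw [Set.indicator_of_notMem hxB, sub_zero, norm_mul]
            calc _ ≤ 1 * M := mul_le_mul (hbound x) (hM x) (norm_nonneg _) zero_le_one
              _ = M := one_mul _
        · rw [Set.indicator_of_notMem hxS, norm_le_zero_iff]
          rcases lt_or_ge |x| √a with hxa | hxa
          · have : x ∈ Set.Ioc (-√B) √B :=
              ⟨by linarith [(abs_lt.1 hxa).1], by linarith [(abs_lt.1 hxa).2]⟩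
            rw [hone x hxa, Set.indicator_of_mem this, Complex.ofReal_one, one_mul, sub_self]
          · have hxb : √b < |x| := by
              by_contra hcon
              rw [not_lt] at hcon
              apply hxS
              rcases abs_cases x with ⟨h, -⟩ | ⟨h, -⟩
              · left; rw [h] at hxa hcon; exact ⟨hxa, hcon⟩
              · right; rw [h] at hxa hcon; constructor <;> linarith
            have : x ∉ Set.Ioc (-√B) √B := fun h => by
              have := abs_le.2 ⟨h.1.le, h.2⟩
              linarith
            rw [hzero x hxb, Set.indicator_of_notMem this, Complex.ofReal_zero, zero_mul, sub_self]
    _ = volume.real S * M := by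
        rw [integral_indicator hSm, setIntegral_const, smul_eq_mul]
    _ ≤ _ := by rw [mul_comm]; gcongr

/-! ### The contribution of a single double coset. -/

/-- The summand of `phi` attached to a matrix `(a, b; c, d)` with `c > 0`, evaluated at
`(x + iy, 0)`. -/
def cuspTerm (h : UnitAddCircle × Real.Angle → ℂ) (T η y a c d x : ℝ) : ℂ :=
  (cutoff T η (y / (c ^ 2 * ((x + d / c) ^ 2 + y ^ 2))) : ℂ) *
    torusLift h (a / c - (x + d / c) / (c ^ 2 * ((x + d / c) ^ 2 + y ^ 2)))
      (-2 * Complex.arg (((x + d / c : ℝ) : ℂ) + y * Complex.I))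

theorem cuspTerm_scaled (h : UnitAddCircle × Real.Angle → ℂ) (T η a d x : ℝ) {y c : ℝ}
    (hy : 0 < y) :
    cuspTerm h T η y a c d (y * x - d / c) = (cutoff T η (1 / (y * c ^ 2) / (x ^ 2 + 1)) : ℂ) *
      torusLift h (a / c - x / (x ^ 2 + 1) / (y * c ^ 2))
        (-2 * Complex.arg ((x : ℂ) + Complex.I)) := by
  have h1 : (x ^ 2 + 1) ≠ 0 := by positivity
  have e1 : y / (c ^ 2 * ((y * x) ^ 2 + y ^ 2)) = 1 / (y * c ^ 2) / (x ^ 2 + 1) := by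
    have : (y * x) ^ 2 + y ^ 2 = y ^ 2 * (x ^ 2 + 1) := by ring
    rw [this]; field_simp
  have e2 : y * x / (c ^ 2 * ((y * x) ^ 2 + y ^ 2)) = x / (x ^ 2 + 1) / (y * c ^ 2) := by
    have : (y * x) ^ 2 + y ^ 2 = y ^ 2 * (x ^ 2 + 1) := by ring
    rw [this]; field_simp
  have e3 : ((y * x : ℝ) : ℂ) + y * Complex.I = (y : ℂ) * ((x : ℂ) + Complex.I) := by
    push_cast; ring
  rw [cuspTerm, sub_add_cancel, e1, e2, e3, Complex.arg_real_mul _ hy]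

/-- After the substitution `x ↦ yx - d/c` the cutoff error and the oscillation error add up; here `Λ
= 1/(yc²)`. -/
theorem SmoothTorus.exists_cuspTerm_bound {h : UnitAddCircle × Real.Angle → ℂ}
    (hh : SmoothTorus h) :
    ∃ M : ℝ, 0 ≤ M ∧ ∀ (m : ℤ) (T η y a c d : ℝ), 1 ≤ T → |η| ≤ 1 / 4 → 0 < y → 0 < c →
      Integrable (fun x : ℝ => cuspTerm h T η y a c d x * e ((m : ℂ) * x)) ∧
      (|(m : ℝ)| ≤ T * c ^ 2 →
        ‖(∫ x : ℝ, cuspTerm h T η y a c d x * e ((m : ℂ) * x)) -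
          y * mainIntegral h m T y c d‖ ≤ y * (M * (1 / √T + 1 / (√y * c * T)))) := by
  obtain ⟨M, hM0, hM, hosc⟩ := hh.exists_mean_free_bound
  refine ⟨700 * M, by positivity, ?_⟩
  intro m T η y a c d hT hη hy hc
  have hT0 : 0 < T := by linarith
  set F : ℝ → ℂ := fun x => cuspTerm h T η y a c d x * e ((m : ℂ) * x) with hF
  set g : ℝ → ℂ := fun x => torusLift h (a / c - x / (x ^ 2 + 1) / (y * c ^ 2))
    (-2 * Complex.arg ((x : ℂ) + Complex.I)) * e ((m : ℂ) * x * y - m * (d / c)) with hg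
  have hgc : Continuous g := by
    have cu : Continuous fun x : ℝ => a / c - x / (x ^ 2 + 1) / (y * c ^ 2) := by
      have : ∀ x : ℝ, x ^ 2 + 1 ≠ 0 := fun x => by positivity
      exact continuous_const.sub ((continuous_id.div (by fun_prop) this).div_const _)
    have cv : Continuous fun x : ℝ => 2 * Real.arctan x - Real.pi := by fun_prop
    simp only [hg, neg_two_mul_arg_add_I]
    exact (hh.continuous_torusLift.comp (cu.prodMk cv)).mul (continuous_e.comp (by fun_prop))
  have hgM : ∀ x, ‖g x‖ ≤ M := by
    intro x
    have : (m : ℂ) * x * y - m * (d / c) = ((m * x * y - m * (d / c) : ℝ) : ℂ) := by push_cast; rfl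
    rw [hg, norm_mul, this, norm_e_ofReal, mul_one]
    exact hM _
  have hFg : ∀ x : ℝ, F (y * x - d / c) =
      (cutoff T η (1 / (y * c ^ 2) / (x ^ 2 + 1)) : ℂ) * g x := by
    intro x
    simp only [hF, hg]
    rw [cuspTerm_scaled h T η a d x hy, mul_assoc]
    congr 3
    push_cast
    ring
  have hΛ : 0 < 1 / (y * c ^ 2) := by positivity
  obtain ⟨hint, hcut⟩ := norm_integral_cutoff_sub_le hT hη hΛ hgc.measurable hgM
  simp only [← hFg] at hint hcut
  constructor
  · have h1 : Integrable fun x => F (x - d / c) :=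
      (integrable_comp_mul_left_iff (fun x => F (x - d / c)) hy.ne').1 hint
    have h2 := h1.comp_add_right (d / c)
    simpa using h2
  · intro hm
    have hosc' := hosc m T y c d (a / c) hT hy hc hm
    have e1 : ∫ x, F x = y * ∫ x, F (y * x - d / c) := by
      rw [Measure.integral_comp_mul_left (fun x => F (x - d / c)) y, integral_sub_right_eq_self,
        abs_of_pos (inv_pos.2 hy), Complex.real_smul, Complex.ofReal_inv, mul_inv_cancel_left₀]
      exact_mod_cast hy.ne'
    have e2 : 1 / (y * c ^ 2) / T = 1 / (T * y * c ^ 2) := by field_simp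
    rw [e2] at hcut
    have e3 : √(1 / (y * c ^ 2)) / T = 1 / (√y * c * T) := by
      rw [Real.sqrt_div zero_le_one, Real.sqrt_one, Real.sqrt_mul hy.le, Real.sqrt_sq hc.le,
        div_div]
    rw [e3] at hcut
    rw [e1, ← mul_sub, norm_mul, Complex.norm_real, Real.norm_of_nonneg hy.le]
    gcongr
    have := norm_add_le_of_le hcut hosc'
    rw [sub_add_sub_cancel] at this
    refine this.trans ?_
    have : 0 ≤ 1 / (√y * c * T) := by positivity
    calc _ = 700 * M * (1 / √T) + 2 * (M * (1 / (√y * c * T))) := by ring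
      _ ≤ 700 * M * (1 / √T) + 700 * (M * (1 / (√y * c * T))) := by gcongr; norm_num
      _ = _ := by ring

/-! ### Matrix entries, translations and cusp stabilizers. -/

variable {Γ : Subgroup G} {κ : OnePoint ℝ} {σ : SL(2, ℝ)}

theorem SL2_mul_apply (g g' : SL(2, ℝ)) (i j : Fin 2) :
    (g * g') i j = g i 0 * g' 0 j + g i 1 * g' 1 j := by
  change (g.1 * g'.1) i j = _
  rw [Matrix.mul_apply, Fin.sum_univ_two]

theorem SL2_det (g : SL(2, ℝ)) : g 0 0 * g 1 1 - g 0 1 * g 1 0 = 1 := by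
  have := g.2
  rwa [Matrix.det_fin_two] at this

theorem SL2_inv_entries (g : SL(2, ℝ)) :
    g⁻¹ 0 0 = g 1 1 ∧ g⁻¹ 0 1 = -g 0 1 ∧ g⁻¹ 1 0 = -g 1 0 ∧ g⁻¹ 1 1 = g 0 0 := by
  rw [Matrix.SpecialLinearGroup.SL2_inv_expl]
  exact ⟨rfl, rfl, rfl, rfl⟩

theorem unip_entries (b : ℝ) :
    unip b 0 0 = 1 ∧ unip b 0 1 = b ∧ unip b 1 0 = 0 ∧ unip b 1 1 = 1 := ⟨rfl, rfl, rfl, rfl⟩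

theorem unip_zero : unip 0 = 1 := by
  ext i j
  fin_cases i <;> fin_cases j <;> simp [unip]

theorem unip_neg (b : ℝ) : unip (-b) = (unip b)⁻¹ := by
  rw [eq_inv_iff_mul_eq_one, unip_mul, neg_add_cancel, unip_zero]

theorem unip_mul_entries (b : ℝ) (g : SL(2, ℝ)) :
    (unip b * g) 0 0 = g 0 0 + b * g 1 0 ∧ (unip b * g) 0 1 = g 0 1 + b * g 1 1 ∧
      (unip b * g) 1 0 = g 1 0 ∧ (unip b * g) 1 1 = g 1 1 := by
  obtain ⟨h1, h2, h3, h4⟩ := unip_entries b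
  simp only [SL2_mul_apply, h1, h2, h3, h4]
  refine ⟨?_, ?_, ?_, ?_⟩ <;> ring

theorem mul_unip_entries (b : ℝ) (g : SL(2, ℝ)) :
    (g * unip b) 0 0 = g 0 0 ∧ (g * unip b) 0 1 = g 0 1 + g 0 0 * b ∧
      (g * unip b) 1 0 = g 1 0 ∧ (g * unip b) 1 1 = g 1 1 + g 1 0 * b := by
  obtain ⟨h1, h2, h3, h4⟩ := unip_entries b
  simp only [SL2_mul_apply, h1, h2, h3, h4]
  refine ⟨?_, ?_, ?_, ?_⟩ <;> ring

theorem unip_intCast_mem (k : ℤ) : unip k ∈ GammaInf := ⟨k, rfl⟩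

theorem mk_neg (g : SL(2, ℝ)) : (QuotientGroup.mk (-g) : G) = QuotientGroup.mk g := by
  rw [eq_comm, QuotientGroup.eq]
  rw [Matrix.SpecialLinearGroup.mem_center_iff]
  refine ⟨-1, by simp, ?_⟩
  ext i j
  fin_cases i <;> fin_cases j <;> simp

theorem mem_lift {g : SL(2, ℝ)} : g ∈ lift Γ ↔ (QuotientGroup.mk g : G) ∈ Γ := Iff.rfl

theorem neg_mem_lift {g : SL(2, ℝ)} : -g ∈ lift Γ ↔ g ∈ lift Γ := by
  rw [mem_lift, mk_neg, mem_lift]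

theorem boundaryAct_mul (g g' : SL(2, ℝ)) (x : OnePoint ℝ) :
    boundaryAct (g * g') x = boundaryAct g (boundaryAct g' x) := by
  simp only [boundaryAct, map_mul, mul_smul]

theorem boundaryAct_one (x : OnePoint ℝ) : boundaryAct 1 x = x := by
  simp [boundaryAct]

theorem boundaryAct_infty_eq_self_iff {g : SL(2, ℝ)} :
    boundaryAct g OnePoint.infty = OnePoint.infty ↔ g 1 0 = 0 := by
  simp [boundaryAct, OnePoint.smul_infty_eq_self_iff]

theorem mem_cuspStabilizer {g : SL(2, ℝ)} :
    g ∈ cuspStabilizer Γ κ ↔ g ∈ lift Γ ∧ boundaryAct g κ = κ := Iff.rfl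

theorem IsScalingMatrix.conj_mem_cuspStabilizer_iff (hσ : IsScalingMatrix Γ κ σ) {A : SL(2, ℝ)} :
    σ * A * σ⁻¹ ∈ cuspStabilizer Γ κ ↔ σ * A * σ⁻¹ ∈ lift Γ ∧ A 1 0 = 0 := by
  have h1 : boundaryAct σ⁻¹ κ = OnePoint.infty := by
    rw [← hσ.1, ← boundaryAct_mul, inv_mul_cancel, boundaryAct_one]
  rw [mem_cuspStabilizer, and_congr_right_iff]
  intro _
  rw [← boundaryAct_infty_eq_self_iff, boundaryAct_mul, h1, boundaryAct_mul]
  constructor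
  · intro h
    rw [← h1]
    nth_rewrite 2 [← h]
    rw [← boundaryAct_mul σ⁻¹, inv_mul_cancel, boundaryAct_one, h1]
  · intro h
    rw [h, hσ.1]

theorem IsScalingMatrix.conj_unip_mem (hσ : IsScalingMatrix Γ κ σ) (k : ℤ) :
    σ * unip k * σ⁻¹ ∈ cuspStabilizer Γ κ := (hσ.2 _).2 (Or.inl (unip_intCast_mem k))

/-! ### Discreteness and the lower bound for lower-left entries. -/

/-- The conjugate of the unit translation by a matrix with first column `(a, c)`. -/
def conjUnip (p : ℝ × ℝ) : SL(2, ℝ) :=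
  ⟨!![1 - p.1 * p.2, p.1 ^ 2; -p.2 ^ 2, 1 + p.1 * p.2], by
    rw [Matrix.det_fin_two_of]; ring⟩

theorem continuous_conjUnip : Continuous conjUnip := by
  refine Continuous.subtype_mk ?_ _
  refine continuous_matrix fun i j => ?_
  fin_cases i <;> fin_cases j <;> simp <;> fun_prop

theorem mul_unip_one_mul_inv (g : SL(2, ℝ)) :
    g * unip 1 * g⁻¹ = conjUnip (g 0 0, g 1 0) := by
  have hd := SL2_det g
  obtain ⟨a1, a2, a3, a4⟩ := SL2_inv_entries g
  obtain ⟨b1, b2, b3, b4⟩ := mul_unip_entries 1 g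
  ext i j
  fin_cases i <;> fin_cases j <;>
    simp [SL2_mul_apply (g * unip 1), a1, a2, a3, a4, b1, b2, b3, b4, conjUnip] <;> linarith

/-- A form of Shimizu's lemma. Conjugating the unit translation by `A` depends only on the first
column of `A`. If that column is near `(1, 0)`, the conjugate is near the translation, hence equal
to it by discreteness, which forces `c = 0`. -/
theorem IsScalingMatrix.exists_lower_left_bound (hσ : IsScalingMatrix Γ κ σ)
    (hΓ : DiscreteTopology (lift Γ)) :
    ∃ c₀ : ℝ, 0 < c₀ ∧ ∀ A : SL(2, ℝ), σ * A * σ⁻¹ ∈ lift Γ → A 1 0 ≠ 0 → c₀ ≤ |A 1 0| := by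
  have hU : σ * unip 1 * σ⁻¹ ∈ lift Γ := by
    have := (hσ.conj_unip_mem 1).1
    rwa [Int.cast_one] at this
  obtain ⟨O, hO, hOu⟩ := isOpen_induced_iff.1
    (isOpen_discrete ({⟨σ * unip 1 * σ⁻¹, hU⟩} : Set (lift Γ)))
  have hc : Continuous fun p : ℝ × ℝ => σ * conjUnip p * σ⁻¹ :=
    (continuous_const.mul continuous_conjUnip).mul continuous_const
  have h10 : conjUnip (1, 0) = unip 1 := by
    ext i j
    fin_cases i <;> fin_cases j <;> simp [conjUnip, unip]
  have hmem : (fun p : ℝ × ℝ => σ * conjUnip p * σ⁻¹) ⁻¹' O ∈ 𝓝 ((1 : ℝ), (0 : ℝ)) := by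
    refine hc.continuousAt.preimage_mem_nhds (hO.mem_nhds ?_)
    rw [h10]
    have : (⟨σ * unip 1 * σ⁻¹, hU⟩ : lift Γ) ∈ Subtype.val ⁻¹' O := by
      rw [hOu]; rfl
    exact this
  obtain ⟨ε, hε, hball⟩ := Metric.mem_nhds_iff.1 hmem
  refine ⟨ε, hε, fun A hA hA0 => ?_⟩
  by_contra hlt
  rw [not_le] at hlt
  -- A left translation changes `a` by multiples of `c`, so a small `c` lets `a` be moved to within
  -- `|c|/2` of `1` without changing `c`.
  set k : ℤ := round ((1 - A 0 0) / A 1 0) with hk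
  set A' := unip k * A with hA'
  obtain ⟨b1, -, b3, -⟩ := unip_mul_entries k A
  have hA'mem : σ * A' * σ⁻¹ ∈ lift Γ := by
    have : σ * A' * σ⁻¹ = (σ * unip k * σ⁻¹) * (σ * A * σ⁻¹) := by rw [hA']; group
    rw [this]
    exact mul_mem (hσ.conj_unip_mem k).1 hA
  have h1 : |A' 0 0 - 1| < ε := by
    have h2 := abs_sub_round ((1 - A 0 0) / A 1 0)
    have h3 : A' 0 0 - 1 = -(((1 - A 0 0) / A 1 0 - k) * A 1 0) := by
      rw [hA', b1]; field_simp; ring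
    rw [h3, abs_neg, abs_mul]
    nlinarith [abs_nonneg (A 1 0)]
  have h2 : (A' 0 0, A' 1 0) ∈ Metric.ball ((1 : ℝ), (0 : ℝ)) ε := by
    rw [Metric.mem_ball, Prod.dist_eq, max_lt_iff, Real.dist_eq, Real.dist_eq, sub_zero]
    exact ⟨h1, by rw [hA', b3]; exact hlt⟩
  have h3 := hball h2
  simp only [Set.mem_preimage] at h3
  rw [← mul_unip_one_mul_inv] at h3
  have h4 : σ * (A' * unip 1 * A'⁻¹) * σ⁻¹ ∈ lift Γ := by
    have : σ * (A' * unip 1 * A'⁻¹) * σ⁻¹ =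
        (σ * A' * σ⁻¹) * (σ * unip 1 * σ⁻¹) * (σ * A' * σ⁻¹)⁻¹ := by group
    rw [this]
    exact mul_mem (mul_mem hA'mem hU) (inv_mem hA'mem)
  have h5 : (⟨_, h4⟩ : lift Γ) ∈ Subtype.val ⁻¹' O := h3
  rw [hOu, Set.mem_singleton_iff, Subtype.mk.injEq, mul_left_inj, mul_right_inj,
    mul_unip_one_mul_inv] at h5
  have h6 : conjUnip (A' 0 0, A' 1 0) 1 0 = unip 1 1 0 := by rw [h5]
  have h7 : -(A' 1 0) ^ 2 = 0 := h6
  apply hA0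
  rw [hA', b3] at h7
  exact pow_eq_zero_iff (n := 2) (by norm_num) |>.1 (neg_eq_zero.1 h7)

/-! ### Spacing of the fractions `d/c` and counting of double cosets. -/

/-- The lower-left entry of a chosen representative of a double coset. -/
def repC (D : PosDoubleCosets Γ σ) : ℝ := (Quotient.out (s := posSetoid Γ σ) D).1 1 0

/-- The lower-right entry of a chosen representative of a double coset. -/
def repD (D : PosDoubleCosets Γ σ) : ℝ := (Quotient.out (s := posSetoid Γ σ) D).1 1 1

/-- A chosen representative of a double coset. -/
def repMat (D : PosDoubleCosets Γ σ) : SL(2, ℝ) := (Quotient.out (s := posSetoid Γ σ) D).1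

theorem repC_pos (D : PosDoubleCosets Γ σ) : 0 < repC D :=
  (Quotient.out (s := posSetoid Γ σ) D).2.2

theorem mul_repMat_mem (D : PosDoubleCosets Γ σ) : σ * repMat D ∈ lift Γ :=
  (Quotient.out (s := posSetoid Γ σ) D).2.1

theorem mainTerm_eq (h : UnitAddCircle × Real.Angle → ℂ) (m : ℤ) (T y : ℝ)
    (D : PosDoubleCosets Γ σ) :
    mainTerm Γ σ h m T y D = mainIntegral h m T y (repC D) (repD D) := by
  conv_lhs => rw [← Quotient.out_eq (s := posSetoid Γ σ) D]
  rfl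

/-- If the last rows of `g` and `g'` are proportional then `g' ∈ Γ_∞ g`. -/
theorem IsScalingMatrix.exists_unip_mul_eq (hσ : IsScalingMatrix Γ κ σ) {g g' : SL(2, ℝ)}
    (hg : σ * g ∈ lift Γ) (hg' : σ * g' ∈ lift Γ) (h0 : 0 < g 1 0) (h0' : 0 < g' 1 0)
    (h : g' 1 0 * g 1 1 = g 1 0 * g' 1 1) : ∃ k : ℤ, g' = unip k * g := by
  obtain ⟨a1, a2, a3, a4⟩ := SL2_inv_entries g
  have hA : σ * (g' * g⁻¹) * σ⁻¹ ∈ cuspStabilizer Γ κ := by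
    rw [hσ.conj_mem_cuspStabilizer_iff]
    constructor
    · have : σ * (g' * g⁻¹) * σ⁻¹ = (σ * g') * (σ * g)⁻¹ := by group
      rw [this]
      exact mul_mem hg' (inv_mem hg)
    · rw [SL2_mul_apply, a1, a3]; linarith
  rcases (hσ.2 _).1 hA with ⟨k, hk⟩ | ⟨k, hk⟩
  · exact ⟨k, by rw [← hk, inv_mul_cancel_right]⟩
  -- The other sign would make the two lower-left entries opposite, but both are positive.
  · exfalso
    have h1 : g' = -(unip k * g) := by
      rw [← hk]; simp
    have h2 : g' 1 0 = -(unip k * g) 1 0 := by rw [h1]; rfl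
    rw [(unip_mul_entries k g).2.2.1] at h2
    linarith

theorem IsScalingMatrix.rep_eq_of_cross (hσ : IsScalingMatrix Γ κ σ)
    (hU : ∀ k : ℤ, unip k ∈ lift Γ) {D D' : PosDoubleCosets Γ σ} {k k' : ℤ}
    (h : repC D' * (repD D + repC D * k) = repC D * (repD D' + repC D' * k')) :
    D = D' ∧ k = k' := by
  have hD : D = D' := by
    obtain ⟨-, -, b3, b4⟩ := mul_unip_entries k (repMat D)
    obtain ⟨-, -, b3', b4'⟩ := mul_unip_entries k' (repMat D')
    obtain ⟨l, hl⟩ := hσ.exists_unip_mul_eq (g := repMat D * unip k) (g' := repMat D' * unip k')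
      (by rw [← mul_assoc]; exact mul_mem (mul_repMat_mem D) (hU k))
      (by rw [← mul_assoc]; exact mul_mem (mul_repMat_mem D') (hU k'))
      (by rw [b3]; exact repC_pos D) (by rw [b3']; exact repC_pos D')
      (by rw [b3, b4, b3', b4']; exact h)
    rw [← Quotient.out_eq (s := posSetoid Γ σ) D, ← Quotient.out_eq (s := posSetoid Γ σ) D']
    refine Quotient.sound (s := posSetoid Γ σ) ?_
    refine DoubleCoset.rel_iff.2 ⟨unip l, unip_intCast_mem l, unip ((k - k' : ℤ) : ℝ),
      unip_intCast_mem _, ?_⟩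
    change repMat D' = unip l * repMat D * unip _
    push_cast
    rw [sub_eq_add_neg, ← unip_mul, unip_neg, ← mul_assoc, mul_assoc (unip (l : ℝ)), ← hl,
      mul_inv_cancel_right]
  subst hD
  refine ⟨rfl, ?_⟩
  have hc := (repC_pos D).ne'
  have h1 := mul_left_cancel₀ hc h
  have h2 := mul_left_cancel₀ hc (add_left_cancel h1)
  exact_mod_cast h2

/-- The cross term is the lower-left entry of `g' g⁻¹`, which lies in `σ⁻¹Γσ`; it is nonzero because
distinct pairs have non-proportional bottom rows. -/
theorem IsScalingMatrix.le_abs_cross (hσ : IsScalingMatrix Γ κ σ)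
    (hU : ∀ k : ℤ, unip k ∈ lift Γ) {c₀ : ℝ}
    (hc₀ : ∀ A : SL(2, ℝ), σ * A * σ⁻¹ ∈ lift Γ → A 1 0 ≠ 0 → c₀ ≤ |A 1 0|)
    {D D' : PosDoubleCosets Γ σ} {k k' : ℤ} (hne : (D, k) ≠ (D', k')) :
    c₀ ≤ |repC D' * (repD D + repC D * k) - repC D * (repD D' + repC D' * k')| := by
  obtain ⟨-, -, b3, b4⟩ := mul_unip_entries k (repMat D)
  obtain ⟨-, -, b3', b4'⟩ := mul_unip_entries k' (repMat D')
  obtain ⟨a1, a2, a3, a4⟩ := SL2_inv_entries (repMat D * unip k)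
  have h10 : (repMat D' * unip k' * (repMat D * unip k)⁻¹) 1 0 =
      repC D' * (repD D + repC D * k) - repC D * (repD D' + repC D' * k') := by
    rw [SL2_mul_apply, a1, a3, b3, b4, b3', b4']
    change repC D' * (repD D + repC D * k) + (repD D' + repC D' * k') * -repC D = _
    ring
  rw [← h10]
  refine hc₀ _ ?_ ?_
  · have : σ * (repMat D' * unip k' * (repMat D * unip k)⁻¹) * σ⁻¹ =
        ((σ * repMat D') * unip k') * ((σ * repMat D) * unip k)⁻¹ := by group
    rw [this]
    exact mul_mem (mul_mem (mul_repMat_mem D') (hU k'))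
      (inv_mem (mul_mem (mul_repMat_mem D) (hU k)))
  · rw [h10, sub_ne_zero]
    intro h
    obtain ⟨rfl, rfl⟩ := hσ.rep_eq_of_cross hU h
    exact hne rfl

theorem IsScalingMatrix.le_repC_sq (hσ : IsScalingMatrix Γ κ σ)
    (hU : ∀ k : ℤ, unip k ∈ lift Γ) {c₀ : ℝ}
    (hc₀ : ∀ A : SL(2, ℝ), σ * A * σ⁻¹ ∈ lift Γ → A 1 0 ≠ 0 → c₀ ≤ |A 1 0|)
    (D : PosDoubleCosets Γ σ) : c₀ ≤ repC D ^ 2 := by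
  -- Comparing a representative with its own unit translate gives the cross term `c²`.
  have := hσ.le_abs_cross hU hc₀ (D := D) (D' := D) (k := 1) (k' := 0) (by simp)
  have h1 : repC D * (repD D + repC D * ((1 : ℤ) : ℝ)) - repC D * (repD D + repC D * ((0 : ℤ) : ℝ)) =
      repC D ^ 2 := by push_cast; ring
  rwa [h1, abs_of_nonneg (sq_nonneg _)] at this

/-- A packing argument: the fractional parts of `d/c` and `d'/c'` differ by at least `c₀/(cc')`, so
intervals of length `c₀/(cX)` to their right are disjoint inside `[0, 2]`. Weighting by `1/c`,
rather than only counting, is needed for the cutoff error. -/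
theorem IsScalingMatrix.sum_inv_repC_le (hσ : IsScalingMatrix Γ κ σ)
    (hU : ∀ k : ℤ, unip k ∈ lift Γ) {c₀ : ℝ} (h0 : 0 < c₀)
    (hc₀ : ∀ A : SL(2, ℝ), σ * A * σ⁻¹ ∈ lift Γ → A 1 0 ≠ 0 → c₀ ≤ |A 1 0|)
    (S : Finset (PosDoubleCosets Γ σ)) {X : ℝ} (hX : 0 < X) (hS : ∀ D ∈ S, repC D ≤ X) :
    ∑ D ∈ S, 1 / repC D ≤ 2 * X / c₀ := by
  classical
  set fr : PosDoubleCosets Γ σ → ℝ := fun D => Int.fract (repD D / repC D) with hfr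
  set I : PosDoubleCosets Γ σ → Set ℝ := fun D => Set.Ico (fr D) (fr D + c₀ / (repC D * X)) with hI
  have hgap : ∀ D ∈ S, ∀ D' ∈ S, D ≠ D' → c₀ / (repC D * X) ≤ |fr D - fr D'| := by
    intro D hD D' hD' hne
    have hc := repC_pos D
    have hc' := repC_pos D'
    have h1 := hσ.le_abs_cross hU hc₀ (D := D) (D' := D') (k := -⌊repD D / repC D⌋)
      (k' := -⌊repD D' / repC D'⌋) (fun h => hne (Prod.ext_iff.1 h).1)
    have h2 : repC D' * (repD D + repC D * ((-⌊repD D / repC D⌋ : ℤ) : ℝ)) -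
        repC D * (repD D' + repC D' * ((-⌊repD D' / repC D'⌋ : ℤ) : ℝ)) =
        (repC D * repC D') * (fr D - fr D') := by
      simp only [hfr, Int.fract]
      push_cast
      field_simp
      ring
    rw [h2, abs_mul, abs_of_pos (mul_pos hc hc')] at h1
    rw [div_le_iff₀ (by positivity)]
    have h3 : repC D * repC D' * |fr D - fr D'| ≤ repC D * X * |fr D - fr D'| := by
      gcongr
      exact hS D' hD'
    linarith
  have hdisj : Set.PairwiseDisjoint (↑S) I := by
    intro D hD D' hD' hne
    rw [Function.onFun, Set.disjoint_left]
    rintro t ⟨h1, h2⟩ ⟨h3, h4⟩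
    have g1 := hgap D hD D' hD' hne
    have g2 := hgap D' hD' D hD hne.symm
    rcases abs_cases (fr D - fr D') with ⟨h, -⟩ | ⟨h, -⟩
    · rw [abs_sub_comm, h] at g2; linarith
    · rw [h] at g1; linarith
  have hsub : (⋃ D ∈ S, I D) ⊆ Set.Icc 0 2 := by
    intro t ht
    simp only [Set.mem_iUnion] at ht
    obtain ⟨D, hD, h1, h2⟩ := ht
    have hc := repC_pos D
    have h3 : c₀ / (repC D * X) ≤ 1 := by
      rw [div_le_one (by positivity)]
      have := hσ.le_repC_sq hU hc₀ D
      nlinarith [hS D hD]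
    exact ⟨(Int.fract_nonneg _).trans h1, by linarith [Int.fract_lt_one (repD D / repC D)]⟩
  have hvol : ∑ D ∈ S, volume.real (I D) ≤ 2 := by
    rw [← measureReal_biUnion_finset hdisj (fun _ _ => measurableSet_Ico) (fun _ _ => by simp [hI])]
    refine (measureReal_mono hsub (by simp)).trans ?_
    rw [Real.volume_real_Icc_of_le (by norm_num)]
    norm_num
  have h1 : ∀ D, volume.real (I D) = c₀ / X * (1 / repC D) := by
    intro D
    have hc := repC_pos D
    rw [Real.volume_real_Ico_of_le (by linarith [div_pos h0 (mul_pos hc hX)])]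
    field_simp
    ring
  simp only [h1] at hvol
  rw [← Finset.mul_sum] at hvol
  rw [le_div_iff₀ h0]
  rw [div_mul_eq_mul_div, div_le_iff₀ hX] at hvol
  linarith

theorem IsScalingMatrix.card_le (hσ : IsScalingMatrix Γ κ σ)
    (hU : ∀ k : ℤ, unip k ∈ lift Γ) {c₀ : ℝ} (h0 : 0 < c₀)
    (hc₀ : ∀ A : SL(2, ℝ), σ * A * σ⁻¹ ∈ lift Γ → A 1 0 ≠ 0 → c₀ ≤ |A 1 0|)
    (S : Finset (PosDoubleCosets Γ σ)) {X : ℝ} (hX : 0 < X) (hS : ∀ D ∈ S, repC D ≤ X) :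
    (S.card : ℝ) ≤ 2 * X ^ 2 / c₀ := by
  have h1 := hσ.sum_inv_repC_le hU h0 hc₀ S hX hS
  have h2 : (S.card : ℝ) * (1 / X) ≤ ∑ D ∈ S, 1 / repC D := by
    rw [← nsmul_eq_mul]
    refine Finset.card_nsmul_le_sum _ _ _ fun D hD => ?_
    exact one_div_le_one_div_of_le (repC_pos D) (hS D hD)
  have h3 := h2.trans h1
  rw [mul_one_div, div_le_iff₀ hX] at h3
  calc _ ≤ _ := h3
    _ = _ := by ring

theorem IsScalingMatrix.finite_repC_le (hσ : IsScalingMatrix Γ κ σ)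
    (hU : ∀ k : ℤ, unip k ∈ lift Γ) {c₀ : ℝ} (h0 : 0 < c₀)
    (hc₀ : ∀ A : SL(2, ℝ), σ * A * σ⁻¹ ∈ lift Γ → A 1 0 ≠ 0 → c₀ ≤ |A 1 0|)
    {X : ℝ} (hX : 0 < X) : {D : PosDoubleCosets Γ σ | repC D ≤ X}.Finite := by
  by_contra hinf
  obtain ⟨S, hS, hcard⟩ := Set.Infinite.exists_subset_card_eq hinf (⌊2 * X ^ 2 / c₀⌋₊ + 1)
  have h1 := hσ.card_le hU h0 hc₀ S hX fun D hD => hS hD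
  rw [hcard] at h1
  push_cast at h1
  linarith [Nat.lt_floor_add_one (2 * X ^ 2 / c₀)]

/-! ### The action on the tangent bundle and the unfolding. -/

theorem coe_smul_eq (g : SL(2, ℝ)) (z : ℍ) :
    ((g • z : ℍ) : ℂ) = ((g 0 0 : ℂ) * z + g 0 1) / ((g 1 0 : ℂ) * z + g 1 1) := by
  rw [UpperHalfPlane.coe_specialLinearGroup_apply]
  rfl

theorem bottom_row_ne_zero (g : SL(2, ℝ)) (z : ℍ) : (g 1 0 : ℂ) * z + g 1 1 ≠ 0 := by
  intro h
  have him := congrArg Complex.im h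
  have hre := congrArg Complex.re h
  simp [z.im_ne_zero] at him
  simp [him] at hre
  have := SL2_det g
  rw [him, hre] at this
  norm_num at this

/-- A sign change shifts the argument by `π` modulo `2π`, and the factor `2` in the action removes
it. -/
theorem tangentAct_neg (g : SL(2, ℝ)) (p : UnitTangent) : tangentAct (-g) p = tangentAct g p := by
  have hne := bottom_row_ne_zero g p.1
  have h1 : ∀ i j, (-g) i j = -g i j := fun i j => rfl
  unfold tangentAct
  congr 1
  · apply UpperHalfPlane.ext
    rw [coe_smul_eq, coe_smul_eq]
    simp only [h1, Complex.ofReal_neg]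
    rw [← neg_div_neg_eq]
    congr 1 <;> ring
  · congr 1
    have h2 : ((-g) 1 0 : ℂ) * p.1 + ((-g) 1 1 : ℂ) = -((g 1 0 : ℂ) * p.1 + g 1 1) := by
      simp only [h1, Complex.ofReal_neg]; ring
    have h3 : ∀ w : ℝ, ((2 * w : ℝ) : Real.Angle) = (2 : ℕ) • (w : Real.Angle) := fun w => by
      rw [two_mul, Real.Angle.coe_add, two_nsmul]
    rw [h2, h3, h3, Complex.arg_neg_coe_angle hne,
      smul_add, Real.Angle.two_nsmul_coe_pi, add_zero]

theorem fCusp_tangentAct_unip_mul (h : UnitAddCircle × Real.Angle → ℂ) (T η : ℝ) (k : ℤ)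
    (g : SL(2, ℝ)) (p : UnitTangent) :
    fCusp h T η (tangentAct (unip k * g) p) = fCusp h T η (tangentAct g p) := by
  have hne := bottom_row_ne_zero g p.1
  obtain ⟨b1, b2, b3, b4⟩ := unip_mul_entries k g
  have hz : (((unip k * g) • p.1 : ℍ) : ℂ) = ((g • p.1 : ℍ) : ℂ) + k := by
    rw [coe_smul_eq, coe_smul_eq, b1, b2, b3, b4]
    push_cast
    field_simp
    ring
  have him : ((unip k * g) • p.1).im = (g • p.1).im := by
    have := congrArg Complex.im hz
    simpa using this
  have hre : ((unip k * g) • p.1).re = (g • p.1).re + k := by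
    have := congrArg Complex.re hz
    simpa using this
  unfold fCusp tangentAct
  rw [him, hre, b3, b4]
  congr 3
  simp

theorem fCusp_tangentAct_eq_cuspTerm (h : UnitAddCircle × Real.Angle → ℂ) (T η : ℝ)
    (g : SL(2, ℝ)) (hg : 0 < g 1 0) (x y : ℝ) (hy : 0 < y) :
    fCusp h T η (tangentAct g (UpperHalfPlane.mk ⟨x, y⟩ hy, 0)) =
      cuspTerm h T η y (g 0 0) (g 1 0) (g 1 1) x := by
  have hdet := SL2_det g
  have hc := hg.ne'
  set z : ℍ := UpperHalfPlane.mk ⟨x, y⟩ hy with hz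
  have hzc : (z : ℂ) = ⟨x, y⟩ := rfl
  have hden : (0 : ℝ) < (x + g 1 1 / g 1 0) ^ 2 + y ^ 2 := by positivity
  have hrow : (g 1 0 : ℂ) * z + g 1 1 =
      (g 1 0 : ℂ) * (((x + g 1 1 / g 1 0 : ℝ) : ℂ) + y * Complex.I) := by
    rw [hzc]
    apply Complex.ext
    · simp; field_simp
    · simp
  have hval : ((g • z : ℍ) : ℂ) =
      ⟨g 0 0 / g 1 0 - (x + g 1 1 / g 1 0) / (g 1 0 ^ 2 * ((x + g 1 1 / g 1 0) ^ 2 + y ^ 2)),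
        y / (g 1 0 ^ 2 * ((x + g 1 1 / g 1 0) ^ 2 + y ^ 2))⟩ := by
    rw [coe_smul_eq, div_eq_iff (bottom_row_ne_zero g z), hrow, hzc]
    have hb : g 0 1 = (g 0 0 * g 1 1 - 1) / g 1 0 := by field_simp; linarith
    rw [hb]
    apply Complex.ext
    · simp
      field_simp
      ring
    · simp
      field_simp
      ring
  have him : (g • z).im = y / (g 1 0 ^ 2 * ((x + g 1 1 / g 1 0) ^ 2 + y ^ 2)) :=
    congrArg Complex.im hval
  have hre : (g • z).re = g 0 0 / g 1 0 -
      (x + g 1 1 / g 1 0) / (g 1 0 ^ 2 * ((x + g 1 1 / g 1 0) ^ 2 + y ^ 2)) :=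
    congrArg Complex.re hval
  unfold fCusp tangentAct cuspTerm torusLift
  simp only
  rw [him, hre, hrow, Complex.arg_real_mul _ hg, zero_sub, ← Real.Angle.coe_neg, neg_mul]

theorem IsScalingMatrix.fCusp_eq_of_rightRel (hσ : IsScalingMatrix Γ κ σ)
    (h : UnitAddCircle × Real.Angle → ℂ) (T η : ℝ) (p : UnitTangent) {γ γ' : SL(2, ℝ)}
    (hγ : γ' * γ⁻¹ ∈ cuspStabilizer Γ κ) :
    fCusp h T η (tangentAct (σ⁻¹ * γ') p) = fCusp h T η (tangentAct (σ⁻¹ * γ) p) := by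
  have h1 : σ * (σ⁻¹ * (γ' * γ⁻¹) * σ) * σ⁻¹ ∈ cuspStabilizer Γ κ := by
    have : σ * (σ⁻¹ * (γ' * γ⁻¹) * σ) * σ⁻¹ = γ' * γ⁻¹ := by group
    rwa [this]
  have h2 : σ⁻¹ * γ' = (σ⁻¹ * (γ' * γ⁻¹) * σ) * (σ⁻¹ * γ) := by group
  rcases (hσ.2 _).1 h1 with ⟨k, hk⟩ | ⟨k, hk⟩
  · rw [h2, hk, fCusp_tangentAct_unip_mul]
  · rw [h2, ← tangentAct_neg, ← neg_mul, hk, fCusp_tangentAct_unip_mul]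

/-- The right cosets over which `phi` sums. -/
abbrev CuspCosets (Γ : Subgroup G) (κ : OnePoint ℝ) : Type :=
  Quotient (QuotientGroup.rightRel ((cuspStabilizer Γ κ).subgroupOf (lift Γ)))

theorem cuspCosets_mk_eq_iff {γ γ' : lift Γ} :
    (Quotient.mk _ γ : CuspCosets Γ κ) = Quotient.mk _ γ' ↔
      (γ' : SL(2, ℝ)) * (γ : SL(2, ℝ))⁻¹ ∈ cuspStabilizer Γ κ := by
  rw [Quotient.eq, QuotientGroup.rightRel_apply, Subgroup.mem_subgroupOf]
  rfl

/-- The coset of `σ g (1, k; 0, 1)` for the chosen representative `g` of a double coset. -/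
def cosetOf (κ : OnePoint ℝ) (hU : ∀ k : ℤ, unip k ∈ lift Γ)
    (i : PosDoubleCosets Γ σ × ℤ) : CuspCosets Γ κ :=
  Quotient.mk _ ⟨σ * repMat i.1 * unip i.2, mul_mem (mul_repMat_mem i.1) (hU i.2)⟩

theorem IsScalingMatrix.cosetOf_injective (hσ : IsScalingMatrix Γ κ σ)
    (hU : ∀ k : ℤ, unip k ∈ lift Γ) : Function.Injective (cosetOf (σ := σ) κ hU) := by
  rintro ⟨D, k⟩ ⟨D', k'⟩ h
  have h1 := cuspCosets_mk_eq_iff.1 h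
  have h2 : σ * repMat D' * unip k' * (σ * repMat D * unip k)⁻¹ =
      σ * (repMat D' * unip k' * (repMat D * unip k)⁻¹) * σ⁻¹ := by group
  simp only [h2] at h1
  have h3 := (hσ.conj_mem_cuspStabilizer_iff.1 h1).2
  obtain ⟨-, -, b3, b4⟩ := mul_unip_entries k (repMat D)
  obtain ⟨-, -, b3', b4'⟩ := mul_unip_entries k' (repMat D')
  obtain ⟨a1, a2, a3, a4⟩ := SL2_inv_entries (repMat D * unip k)
  rw [SL2_mul_apply, a1, a3, b3, b4, b3', b4'] at h3
  obtain ⟨rfl, rfl⟩ := hσ.rep_eq_of_cross hU (D := D) (D' := D') (k := k) (k' := k')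
    (by change repMat D' 1 0 * (repMat D 1 1 + repMat D 1 0 * k) =
          repMat D 1 0 * (repMat D' 1 1 + repMat D' 1 0 * k')
        linarith)
  rfl

theorem IsScalingMatrix.fCusp_cosetOf (hσ : IsScalingMatrix Γ κ σ)
    (hU : ∀ k : ℤ, unip k ∈ lift Γ) (h : UnitAddCircle × Real.Angle → ℂ) (T η x y : ℝ)
    (hy : 0 < y) (i : PosDoubleCosets Γ σ × ℤ) :
    fCusp h T η (tangentAct (σ⁻¹ * ((cosetOf κ hU i).out : SL(2, ℝ)))
      (UpperHalfPlane.mk ⟨x, y⟩ hy, 0)) =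
      cuspTerm h T η y (repMat i.1 0 0) (repC i.1) (repD i.1) (x + i.2) := by
  have h1 := cuspCosets_mk_eq_iff.1 (Quotient.out_eq (cosetOf κ hU i))
  rw [← hσ.fCusp_eq_of_rightRel h T η _ h1]
  obtain ⟨b1, -, b3, b4⟩ := mul_unip_entries i.2 (repMat i.1)
  have h2 : σ⁻¹ * (σ * repMat i.1 * unip i.2) = repMat i.1 * unip i.2 := by group
  simp only [h2]
  have hc := repC_pos i.1
  rw [fCusp_tangentAct_eq_cuspTerm _ _ _ _ (by rw [b3]; exact hc), b1, b3, b4]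
  change cuspTerm h T η y (repMat i.1 0 0) (repC i.1) (repD i.1 + repC i.1 * i.2) x = _
  have h3 : x + (repD i.1 + repC i.1 * i.2) / repC i.1 = x + i.2 + repD i.1 / repC i.1 := by
    field_simp; ring
  unfold cuspTerm
  rw [h3]

/-- With injectivity, this parametrises the cosets having `c ≠ 0` by a double coset and an integer
translation. The sign `δ` normalises `c > 0`, and is invisible because the cusp stabilizer contains
`-1`. -/
theorem IsScalingMatrix.exists_cosetOf_eq (hσ : IsScalingMatrix Γ κ σ)
    (hU : ∀ k : ℤ, unip k ∈ lift Γ) (q : CuspCosets Γ κ)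
    (hq : (σ⁻¹ * (q.out : SL(2, ℝ))) 1 0 ≠ 0) : ∃ i, cosetOf (σ := σ) κ hU i = q := by
  have key : ∀ g : SL(2, ℝ), 0 < g 1 0 → (∃ δ : SL(2, ℝ), (δ = 1 ∨ δ = -1) ∧
      σ⁻¹ * (q.out : SL(2, ℝ)) = δ * g) → ∃ i, cosetOf (σ := σ) κ hU i = q := by
    rintro g hg ⟨δ, hδ, hgq⟩
    have hgm : σ * g ∈ lift Γ := by
      have hm : σ * (δ * g) ∈ lift Γ := by
        rw [← hgq, mul_inv_cancel_left]; exact q.out.2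
      rcases hδ with rfl | rfl
      · rwa [one_mul] at hm
      · rwa [neg_mul, one_mul, mul_neg, neg_mem_lift] at hm
    set D : PosDoubleCosets Γ σ := Quotient.mk (posSetoid Γ σ) ⟨g, hgm, hg⟩ with hD
    have hrel := Quotient.mk_out (s := posSetoid Γ σ) (⟨g, hgm, hg⟩ : PosElements Γ σ)
    obtain ⟨_, ⟨k, rfl⟩, _, ⟨l, rfl⟩, hkl⟩ := DoubleCoset.rel_iff.1 hrel
    change g = unip k * repMat D * unip l at hkl
    refine ⟨(D, l), ?_⟩
    conv_rhs => rw [← Quotient.out_eq q]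
    refine cuspCosets_mk_eq_iff.2 ?_
    have h1 : (q.out : SL(2, ℝ)) = σ * (δ * (unip k * repMat D * unip l)) := by
      rw [← hkl, ← hgq, mul_inv_cancel_left]
    have h2 : (q.out : SL(2, ℝ)) * (σ * repMat D * unip l)⁻¹ = σ * (δ * unip k) * σ⁻¹ := by
      rw [h1]; group
    change (q.out : SL(2, ℝ)) * (σ * repMat D * unip l)⁻¹ ∈ _
    rw [h2, hσ.2]
    rcases hδ with rfl | rfl
    · left; rw [one_mul]; exact unip_intCast_mem k
    · right; rw [neg_mul, one_mul, neg_neg]; exact unip_intCast_mem k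
  rcases lt_or_gt_of_ne hq with hneg | hpos
  · refine key (-(σ⁻¹ * (q.out : SL(2, ℝ)))) ?_ ⟨-1, Or.inr rfl, by simp⟩
    change 0 < -((σ⁻¹ * (q.out : SL(2, ℝ))) 1 0)
    linarith
  · exact key _ hpos ⟨1, Or.inl rfl, by simp⟩

theorem cuspTerm_eq_zero (h : UnitAddCircle × Real.Angle → ℂ) {T η y c : ℝ} (a d x : ℝ)
    (hy : 0 < y) (hc : 0 < c) (hcX : 1 < (T - |η|) * y * c ^ 2) :
    cuspTerm h T η y a c d x = 0 := by
  rw [cuspTerm, cutoff_eq_zero, Complex.ofReal_zero, zero_mul]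
  rw [div_lt_iff₀ (by positivity)]
  have h1 : 0 < T - |η| := by
    by_contra hcon
    have : (T - |η|) * (y * c ^ 2) ≤ 0 :=
      mul_nonpos_of_nonpos_of_nonneg (not_lt.1 hcon) (by positivity)
    linarith
  have h2 : 0 ≤ (T - |η|) * (c ^ 2 * (x + d / c) ^ 2) := by positivity
  nlinarith

/-- Unfolding of the horocycle average of `phi`. -/
theorem IsScalingMatrix.integral_phi_eq (hσ : IsScalingMatrix Γ κ σ)
    (hU : ∀ k : ℤ, unip k ∈ lift Γ)
    (hinf : ∀ g : SL(2, ℝ), σ * g ∈ lift Γ → g 1 0 = 0 → g 1 1 ^ 2 = 1)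
    (h : UnitAddCircle × Real.Angle → ℂ) (m : ℤ) {T η y : ℝ} (hy : 0 < y) (hyT : y < T - |η|)
    (hint : ∀ a c d : ℝ, 0 < c →
      Integrable fun x : ℝ => cuspTerm h T η y a c d x * e ((m : ℂ) * x))
    (S : Finset (PosDoubleCosets Γ σ)) (hS : ∀ D, (T - |η|) * y * repC D ^ 2 ≤ 1 → D ∈ S) :
    ∫ x in (0 : ℝ)..1, phi Γ κ σ h T η (UpperHalfPlane.mk ⟨x, y⟩ hy, 0) * e ((m : ℂ) * x) =
      ∑ D ∈ S, ∫ x : ℝ, cuspTerm h T η y (repMat D 0 0) (repC D) (repD D) x * e ((m : ℂ) * x) := by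
  set W : S → ℝ → ℂ := fun D x =>
    cuspTerm h T η y (repMat D.1 0 0) (repC D.1) (repD D.1) x * e ((m : ℂ) * x) with hW
  have hWint : ∀ D, Integrable (W D) := fun D => hint _ _ _ (repC_pos D.1)
  set ι : S × ℤ → CuspCosets Γ κ := fun i => cosetOf (σ := σ) κ hU (i.1.1, i.2) with hι
  have hιinj : Function.Injective ι := by
    rintro ⟨D, k⟩ ⟨D', k'⟩ hi
    have := hσ.cosetOf_injective hU hi
    rw [Prod.mk.injEq] at this
    exact Prod.ext (Subtype.ext this.1) this.2
  have hphi : ∀ x : ℝ, phi Γ κ σ h T η (UpperHalfPlane.mk ⟨x, y⟩ hy, 0) * e ((m : ℂ) * x) =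
      ∑' i : S × ℤ, W i.1 (x + i.2) := by
    intro x
    have hsupp : Function.support (fun γ : CuspCosets Γ κ => fCusp h T η
        (tangentAct (σ⁻¹ * (γ.out : SL(2, ℝ))) (UpperHalfPlane.mk ⟨x, y⟩ hy, 0))) ⊆
        Set.range ι := by
      intro q hq
      rw [Function.mem_support] at hq
      by_cases hc : (σ⁻¹ * (q.out : SL(2, ℝ))) 1 0 = 0
      -- With `c = 0` and `d = ±1` the matrix acts as a horizontal translation, so the height stays
      -- `y` and the cutoff vanishes.
      · exfalso
        apply hq
        have h11 := hinf (σ⁻¹ * (q.out : SL(2, ℝ)))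
          (by rw [mul_inv_cancel_left]; exact q.out.2) hc
        set g := σ⁻¹ * (q.out : SL(2, ℝ))
        have hdet := SL2_det g
        rw [hc, mul_zero, sub_zero] at hdet
        have h00 : g 0 0 = g 1 1 := by
          have h0 : g 1 1 ≠ 0 := fun h0 => by rw [h0] at hdet; norm_num at hdet
          exact mul_right_cancel₀ h0 (by linear_combination hdet - h11)
        have h0 : g 1 1 ≠ 0 := fun h0 => by rw [h0] at h11; norm_num at h11
        have hval : ((g • UpperHalfPlane.mk ⟨x, y⟩ hy : ℍ) : ℂ) = ⟨x + g 0 1 / g 1 1, y⟩ := by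
          rw [coe_smul_eq, hc, h00]
          have h0' : (g 1 1 : ℂ) ≠ 0 := by exact_mod_cast h0
          rw [div_eq_iff (by simpa using h0')]
          change (g 1 1 : ℂ) * (⟨x, y⟩ : ℂ) + g 0 1 = _
          apply Complex.ext
          · simp; field_simp
          · simp; ring
        have him : (g • UpperHalfPlane.mk ⟨x, y⟩ hy).im = y := congrArg Complex.im hval
        unfold fCusp tangentAct
        simp only
        rw [him, cutoff_eq_zero hyT, Complex.ofReal_zero, zero_mul]
      · obtain ⟨⟨D, k⟩, rfl⟩ := hσ.exists_cosetOf_eq hU q hc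
        have hD : D ∈ S := by
          apply hS
          by_contra hcon
          apply hq
          rw [hσ.fCusp_cosetOf hU]
          exact cuspTerm_eq_zero h _ _ _ hy (repC_pos D) (not_le.1 hcon)
        exact ⟨(⟨D, hD⟩, k), rfl⟩
    unfold phi
    rw [← hιinj.tsum_eq hsupp, ← tsum_mul_right]
    refine tsum_congr fun i => ?_
    rw [hι, hσ.fCusp_cosetOf hU]
    simp only [hW]
    congr 1
    -- Periodicity of `e(mx)` lets the character be translated along with the summand.
    have : (m : ℂ) * x = m * ((x + i.2 : ℝ) : ℂ) - ((m * i.2 : ℤ) : ℂ) := by push_cast; ring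
    rw [this, e_sub_int]
  simp only [hphi]
  have hFint : ∀ i : S × ℤ, Integrable (fun x : ℝ => W i.1 (x + i.2))
      (volume.restrict (Set.Ioc 0 1)) := fun i =>
    ((hWint i.1).comp_add_right (i.2 : ℝ)).integrableOn
  have hsum : Summable fun i : S × ℤ => ∫ x in Set.Ioc (0 : ℝ) 1, ‖W i.1 (x + i.2)‖ := by
    rw [summable_prod_of_nonneg fun i => integral_nonneg fun x => norm_nonneg _]
    refine ⟨fun D => ?_, (hasSum_fintype _).summable⟩
    have := (hWint D).norm.hasSum_intervalIntegral_comp_add_int.summable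
    simpa only [intervalIntegral.integral_of_le zero_le_one] using this
  have hmain := hasSum_integral_of_summable_integral_norm hFint hsum
  have hfib := hmain.prod_fiberwise (g := fun D => ∫ x, W D x) fun D => by
    have := (hWint D).hasSum_intervalIntegral_comp_add_int
    simpa only [intervalIntegral.integral_of_le zero_le_one] using this
  rw [intervalIntegral.integral_of_le zero_le_one, ← (hasSum_fintype _).unique hfib]
  exact Finset.sum_coe_sort S fun D => ∫ x : ℝ, cuspTerm h T η y (repMat D 0 0) (repC D)
    (repD D) x * e ((m : ℂ) * x)

/-! ### Summing the errors and the final theorem. -/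

/-- The horocycle estimate for a cusp `κ` with scaling matrix `σ`, when `∞` is also a cusp of
width one and the elements of `σ⁻¹ Γ` fixing `∞` are translations. -/
theorem IsScalingMatrix.exists_horocycle_bound (hσ : IsScalingMatrix Γ κ σ)
    (hΓ : DiscreteTopology (lift Γ)) (hU : ∀ k : ℤ, unip k ∈ lift Γ)
    (hinf : ∀ g : SL(2, ℝ), σ * g ∈ lift Γ → g 1 0 = 0 → g 1 1 ^ 2 = 1)
    {h : UnitAddCircle × Real.Angle → ℂ} (hh : SmoothTorus h) :
    ∃ C c₀ : ℝ, 0 < c₀ ∧ ∀ (m : ℤ) (T η y : ℝ) (hy : 0 < y), 1 ≤ T → |(m : ℝ)| / c₀ ≤ T →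
      |η| ≤ 1 / 4 → y < T - |η| →
      ‖(∫ x in (0 : ℝ)..1, phi Γ κ σ h T η (UpperHalfPlane.mk ⟨x, y⟩ hy, 0) * e ((m : ℂ) * x)) -
        (y : ℂ) * ∑' D : PosDoubleCosets Γ σ, mainTerm Γ σ h m T y D‖ ≤
          C * T ^ (-(3 / 2 : ℝ)) := by
  obtain ⟨c₀, h0, hc₀⟩ := hσ.exists_lower_left_bound hΓ
  obtain ⟨M, hM0, hM⟩ := hh.exists_cuspTerm_bound
  refine ⟨8 * M / c₀, c₀, h0, fun m T η y hy hT hmT hη hyT => ?_⟩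
  have hT0 : 0 < T := by linarith
  have hη0 := abs_nonneg η
  set A := (T - |η|) * y with hA
  have hA0 : 0 < A := mul_pos (by linarith) hy
  -- For `c > X` even the maximal height `1/(yc²)` lies below `T - |η|`, so both the unfolded term
  -- and the main term vanish.
  set X := 1 / √A with hX
  have hX0 : 0 < X := by positivity
  have hX2 : A * X ^ 2 = 1 := by
    rw [hX, div_pow, Real.sq_sqrt hA0.le]; field_simp
  set S := (hσ.finite_repC_le hU h0 hc₀ hX0).toFinset with hS
  have hSX : ∀ D ∈ S, repC D ≤ X := fun D hD => by simpa [hS] using hD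
  have hmem : ∀ D : PosDoubleCosets Γ σ, A * repC D ^ 2 ≤ 1 → D ∈ S := by
    intro D hD
    have : repC D ≤ X := by
      refine abs_le_of_sq_le_sq' ?_ hX0.le |>.2
      rw [← hX2] at hD
      exact le_of_mul_le_mul_left hD hA0
    simpa [hS] using this
  rw [hσ.integral_phi_eq hU hinf h m hy hyT
    (fun a c d hc => (hM m T η y a c d hT hη hy hc).1) S hmem]
  have htsum : ∑' D : PosDoubleCosets Γ σ, mainTerm Γ σ h m T y D =
      ∑ D ∈ S, mainIntegral h m T y (repC D) (repD D) := by
    rw [tsum_eq_sum (s := S)]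
    · exact Finset.sum_congr rfl fun D _ => mainTerm_eq h m T y D
    · intro D hD
      have hc := repC_pos D
      have h1 : 1 < A * repC D ^ 2 := not_le.1 fun h => hD (hmem D h)
      have h2 : 1 / (T * y * repC D ^ 2) - 1 ≤ 0 := by
        rw [sub_nonpos, div_le_one (by positivity)]
        have : A * repC D ^ 2 ≤ T * y * repC D ^ 2 := by
          rw [hA]; gcongr; linarith
        linarith
      rw [mainTerm_eq, mainIntegral, max_eq_right h2, Real.sqrt_zero, neg_zero,
        intervalIntegral.integral_same]
  rw [htsum, Finset.mul_sum, ← Finset.sum_sub_distrib]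
  have hterm : ∀ D ∈ S, ‖(∫ x : ℝ, cuspTerm h T η y (repMat D 0 0) (repC D) (repD D) x *
      e ((m : ℂ) * x)) - y * mainIntegral h m T y (repC D) (repD D)‖ ≤
      y * M / √T + √y * M / T * (1 / repC D) := by
    intro D _
    have hc := repC_pos D
    have h1 : |(m : ℝ)| ≤ T * repC D ^ 2 := by
      rw [div_le_iff₀ h0] at hmT
      have := hσ.le_repC_sq hU hc₀ D
      nlinarith
    refine ((hM m T η y (repMat D 0 0) (repC D) (repD D) hT hη hy hc).2 h1).trans (le_of_eq ?_)
    have hsy : 0 < √y := Real.sqrt_pos.2 hy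
    have hyy : y = √y * √y := (Real.mul_self_sqrt hy.le).symm
    have : y * (1 / (√y * repC D * T)) = √y / T * (1 / repC D) := by
      nth_rewrite 1 [hyy]
      field_simp
    calc _ = y * M / √T + M * (y * (1 / (√y * repC D * T))) := by ring
      _ = _ := by rw [this]; ring
  refine (norm_sum_le_of_le S hterm).trans ?_
  rw [Finset.sum_add_distrib, Finset.sum_const, nsmul_eq_mul, ← Finset.mul_sum]
  have hcard := hσ.card_le hU h0 hc₀ S hX0 hSX
  have hsum := hσ.sum_inv_repC_le hU h0 hc₀ S hX0 hSX
  have hsT : 0 < √T := Real.sqrt_pos.2 hT0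
  -- Since `|η| ≤ 1/4` and `T ≥ 1`, one has `T - |η| ≥ T/2`.
  have hyX : y * X ^ 2 ≤ 2 / T := by
    rw [le_div_iff₀ hT0]
    have : y * X ^ 2 * (T - |η|) = 1 := by rw [← hX2, hA]; ring
    have hp : 0 ≤ y * X ^ 2 := by positivity
    nlinarith
  have hsyX : √y * X ≤ 2 / √T := by
    refine abs_le_of_sq_le_sq' ?_ (by positivity) |>.2
    rw [mul_pow, Real.sq_sqrt hy.le, div_pow 2 (√T), Real.sq_sqrt hT0.le]
    refine hyX.trans ?_
    gcongr
    norm_num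
  have hpow : T ^ (-(3 / 2 : ℝ)) = 1 / (T * √T) := by
    rw [Real.rpow_neg hT0.le, Real.sqrt_eq_rpow, ← Real.rpow_one_add' hT0.le (by norm_num), one_div]
    norm_num
  rw [hpow]
  calc (S.card : ℝ) * (y * M / √T) + √y * M / T * ∑ D ∈ S, 1 / repC D
      ≤ 2 * X ^ 2 / c₀ * (y * M / √T) + √y * M / T * (2 * X / c₀) := by gcongr
    _ = 2 * M / (c₀ * √T) * (y * X ^ 2) + 2 * M / (c₀ * T) * (√y * X) := by
        field_simp
    _ ≤ 2 * M / (c₀ * √T) * (2 / T) + 2 * M / (c₀ * T) * (2 / √T) := by gcongr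
    _ = 8 * M / c₀ * (1 / (T * √T)) := by
        field_simp
        ring

end Horocycle

end

theorem mainTheorem4 {q : ℕ} [NeZero q]
    (Γ : Subgroup Horocycle.G) (hΓ : Horocycle.IsCofiniteFuchsian Γ)
    (κ : Fin q → OnePoint ℝ) (hκ : ∀ i, Horocycle.IsCuspOf Γ (κ i))
    (hκ_ineq : ∀ i i', i ≠ i' → ∀ γ ∈ Horocycle.lift Γ, Horocycle.boundaryAct γ (κ i) ≠ κ i')
    (σ : Fin q → SL(2, ℝ)) (hσ : ∀ i, Horocycle.IsScalingMatrix Γ (κ i) (σ i))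
    (hκ_zero : κ 0 = OnePoint.infty)
    (hσ_zero : (QuotientGroup.mk (σ 0) : Horocycle.G) = 1)
    (h : UnitAddCircle × Real.Angle → ℂ) (hh : Horocycle.SmoothTorus h) (j : Fin q) :
    ∃ C : ℝ, ∀ B₀ B₁ : ℝ, 1 < B₀ → B₀ < B₁ → ∀ m : ℤ,
      ∃ T₀ : ℝ, ∀ T : ℝ, T₀ ≤ T → B₁ ≤ T →
        ∀ η : ℝ, |η| ≤ min ((B₁ - B₀) / 2) (1 / 4) →
        ∀ (y : ℝ) (hy : 0 < y), y < T - min ((B₁ - B₀) / 2) (1 / 4) →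
          ‖(∫ x in (0 : ℝ)..1,
                Horocycle.phi Γ (κ j) (σ j) h T η (UpperHalfPlane.mk ⟨x, y⟩ hy, 0) *
                  Horocycle.e ((m : ℂ) * x)) -
              (y : ℂ) * ∑' D : Horocycle.PosDoubleCosets Γ (σ j),
                Horocycle.mainTerm Γ (σ j) h m T y D‖ ≤
            C * T ^ (-(3 / 2 : ℝ)) := by
  -- The lift of the identity scaling matrix is known only up to a central sign, which conjugation
  -- does not see.
  have hcenter : σ 0 ∈ Subgroup.center SL(2, ℝ) := (QuotientGroup.eq_one_iff _).1 hσ_zero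
  have hconj : ∀ g, σ 0 * g * (σ 0)⁻¹ = g := fun g => by
    rw [← Subgroup.mem_center_iff.1 hcenter g, mul_inv_cancel_right]
  have hU : ∀ k : ℤ, Horocycle.unip k ∈ Horocycle.lift Γ := by
    intro k
    have := ((hσ 0).conj_unip_mem k).1
    rwa [hconj] at this
  have hinf : ∀ g : SL(2, ℝ), σ j * g ∈ Horocycle.lift Γ → g 1 0 = 0 → g 1 1 ^ 2 = 1 := by
    intro g hg hg0
    have hfix : Horocycle.boundaryAct (σ j * g) (κ 0) = κ j := by
      rw [hκ_zero, Horocycle.boundaryAct_mul,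
        Horocycle.boundaryAct_infty_eq_self_iff.2 hg0, (hσ j).1]
    -- An element of `Γ` carrying `∞` to `κ j` contradicts inequivalence unless `j = 0`; then `g`
    -- lies in the stabilizer of `∞`, which is `±Γ_∞`.
    obtain rfl : (0 : Fin q) = j := by
      by_contra hne
      exact hκ_ineq 0 j hne _ hg hfix
    have hgl : g ∈ Horocycle.lift Γ := by
      rw [Horocycle.mem_lift, QuotientGroup.mk_mul, hσ_zero, one_mul] at hg
      exact hg
    have hmem : σ 0 * g * (σ 0)⁻¹ ∈ Horocycle.cuspStabilizer Γ (κ 0) :=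
      (hσ 0).conj_mem_cuspStabilizer_iff.2 ⟨by rwa [hconj], hg0⟩
    rcases ((hσ 0).2 g).1 hmem with ⟨k, hk⟩ | ⟨k, hk⟩
    · rw [hk, (Horocycle.unip_entries k).2.2.2, one_pow]
    · have h1 : (-g) 1 1 = 1 := by rw [hk]; exact (Horocycle.unip_entries k).2.2.2
      have h2 : -(g 1 1) = 1 := h1
      rw [← neg_sq, h2, one_pow]
  obtain ⟨C, c₀, hc₀, hC⟩ := (hσ j).exists_horocycle_bound hΓ.1 hU hinf hh
  refine ⟨C, fun B₀ B₁ hB₀ hB₁ m => ⟨|(m : ℝ)| / c₀, fun T hT₀ hB₁T η hη y hy hyT => ?_⟩⟩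
  exact hC m T η y hy (by linarith) hT₀ (hη.trans (min_le_right _ _)) (by linarith)
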